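/- **Conventions.** For a discrete group $\pi$, $B\pi=K(\pi,1)$ denotes an Eilenberg–MacLane space of $\pi$: a path-connected space with $\pi_1(B\pi)\cong\pi$ and contractible universal covering space (as usual $B\pi$ is taken to be a CW complex or, more generally, a paracompact Hausdorff, locally path-connected space, so that it is unique up to homotopy equivalence). For a homomorphism $f:G\to H$, $Bf:BG\to BH$ denotes any based map that induces $f$ on fundamental groups. For a map $\varphi:X\to Y$ of nonempty spaces, $\operatorname{cat}(\varphi)$ is the least $k\ge 0$ such that $X$ is covered by $k+1$ open sets $U_0,\dots,U_k$ with each $\varphi|_{U_i}$ nullhomotopic ($\infty$ if there is none), and $\operatorname{TC}(\varphi)$ is the least $k\ge 0$ such that $X\times X$ is covered by $k+1$ open sets $U_0,\dots,U_k$, each admitting a continuous map $s_i:U_i\to Y^{[0,1]}$ with $s_i(x_0,x_1)(0)=\varphi(x_0)$ and $s_i(x_0,x_1)(1)=\varphi(x_1)$ ($\infty$ if there is none). For a group homomorphism $f$ put $\operatorname{cat}(f)=\operatorname{cat}(Bf)$ and $\operatorname{TC}(f)=\operatorname{TC}(Bf)$. For a group $\pi$ let $I(\pi)\subset\mathbb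 Z[\pi]$ be the augmentation ideal and let $\beta_\pi\in H^1(\pi;I(\pi))$ be the Berstein–Schwarz class, represented by the cocycle $g\mapsto g-1$; let $\beta_\pi^k\in H^k(\pi;I(\pi)^{\otimes k})$ be its $k$-th cup power, with $\beta_\pi^0=1\in H^0(\pi;\mathbb Z)$. **Theorem.** Let $n,m\ge 0$ and let $f:\mathbb Z^n\to\mathbb Z^m$ be a group homomorphism. Then $$\operatorname{cat}(f)=\operatorname{TC}(f)=\max\{\,k\ge 0 \mid f^*\beta_{\mathbb Z^m}^k\neq 0\,\}=\operatorname{rank}(f),$$ where $f^*\beta_{\mathbb Z^m}^k\in H^k(\mathbb Z^n;f^*I(\mathbb Z^m)^{\otimes k})$ and $\operatorname{rank}(f)$ is the rank of the free abelian group $\operatorname{im}(f)$. The values of $\operatorname{cat}$ and $\operatorname{TC}$ hold for every choice of $B\mathbb Z^n$, $B\mathbb Z^m$ and $Bf$. -/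

import Mathlib

open CategoryTheory MonoidalCategory
open scoped unitInterval MonoidAlgebra

universe u v

noncomputable section

namespace HomCat

/-! ### LS-category and topological complexity of a map -/

section Maps

variable {X : Type u} {Y : Type v} [TopologicalSpace X] [TopologicalSpace Y]

/-- The domain of `φ` is covered by `k + 1` open sets (possibly empty, possibly repeated)
on each of which `φ` is nullhomotopic. -/
def CatLE (φ : C(X, Y)) (k : ℕ) : Prop :=
  ∃ U : Fin (k + 1) → Set X, (∀ i, IsOpen (U i)) ∧ (⋃ i, U i) = Set.univ ∧
    ∀ i, (φ.restrict (U i)).Nullhomotopic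

/-- The reduced Lusternik–Schnirelmann category of a map with nonempty domain: the least `k` such
that `CatLE φ k`, and `⊤` if there is none. -/
def cat (φ : C(X, Y)) : ℕ∞ := ⨅ (k : ℕ) (_ : CatLE φ k), (k : ℕ∞)

/-- A `φ`-motion planner on `Z ⊆ X × X`: a continuous map `s : Z → Y^I` (compact-open topology)
such that `s (x₀, x₁)` is a path from `φ x₀` to `φ x₁`. -/
def IsMotionPlanner (φ : C(X, Y)) (Z : Set (X × X)) (s : C(Z, C(I, Y))) : Prop :=
  ∀ z : Z, s z 0 = φ z.1.1 ∧ s z 1 = φ z.1.2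

/-- `X × X` is covered by `k + 1` open sets which carry `φ`-motion planners. -/
def TCLE (φ : C(X, Y)) (k : ℕ) : Prop :=
  ∃ U : Fin (k + 1) → Set (X × X), (∀ i, IsOpen (U i)) ∧ (⋃ i, U i) = Set.univ ∧
    ∀ i, ∃ s : C(U i, C(I, Y)), IsMotionPlanner φ (U i) s

/-- The reduced (pullback) topological complexity of a map with nonempty domain: the least `k`
such that `TCLE φ k`, and `⊤` if there is none. -/
def TC (φ : C(X, Y)) : ℕ∞ := ⨅ (k : ℕ) (_ : TCLE φ k), (k : ℕ∞)

end Maps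

/-! ### Eilenberg–MacLane spaces `K(G, 1)` and maps between them -/

/-- The structure of an Eilenberg–MacLane space `BG = K(G, 1)` on `X`: a connected space with
fundamental group (identified with) `G` and contractible universal covering space.
The point-set conditions hold for every connected CW complex. -/
structure EilenbergMacLane (G : Type) [Group G] (X : Type u) [TopologicalSpace X] where
  t2 : T2Space X
  paracompact : ParacompactSpace X
  pathConnected : PathConnectedSpace X
  locallyPathConnected : LocallyPathConnectedSpace X
  contractible_covering : ∃ (E : Type u) (_ : TopologicalSpace E) (p : E → X),
    ContractibleSpace E ∧ IsCoveringMap p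
  base : X
  pi1 : FundamentalGroup X base ≃* G

/-- `φ : BG → BH` is a model of `Bf`: it preserves base points and induces `f : G → H` on
fundamental groups. -/
def Induces {G H : Type} [Group G] [Group H] {X : Type u} {Y : Type v} [TopologicalSpace X]
    [TopologicalSpace Y] (KX : EilenbergMacLane G X) (KY : EilenbergMacLane H Y)
    (φ : C(X, Y)) (f : G →* H) : Prop :=
  ∃ h : φ KX.base = KY.base, ∀ γ : FundamentalGroup X KX.base,
    KY.pi1 (FundamentalGroup.mapOfEq φ h γ) = f (KX.pi1 γ)

/-! ### The Berstein–Schwarz class and its cup powers -/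

section Berstein

variable (G : Type) [Group G]

/-- The augmentation `ℤ[G] → ℤ`, as a `ℤ`-linear map. -/
def augmentation : ℤ[G] →ₗ[ℤ] ℤ :=
  (MonoidAlgebra.lift ℤ ℤ G (1 : G →* ℤ)).toLinearMap

theorem augmentation_single (g : G) (a : ℤ) :
    augmentation G (MonoidAlgebra.single g a) = a := by
  simp [augmentation]

theorem augmentation_ρ (g : G) (x : ℤ[G]) :
    augmentation G ((Rep.leftRegular ℤ G).ρ g x) = augmentation G x := by
  suffices h : augmentation G ∘ₗ (Rep.leftRegular ℤ G).ρ g = augmentation G from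
    LinearMap.congr_fun h x
  ext y
  simp [augmentation]

/-- The augmentation ideal `I(G) = ker (ℤ[G] → ℤ)` with `G` acting by left multiplication. -/
def augIdeal : Rep ℤ G :=
  Rep.subrepresentation (Rep.leftRegular ℤ G) (LinearMap.ker (augmentation G))
    (fun g x hx => by
      rw [Submodule.mem_comap, LinearMap.mem_ker, augmentation_ρ]
      exact hx)

/-- The function `g ↦ g - 1` from `G` to `I(G)`, as an inhomogeneous `1`-cochain. -/
def bersteinCochain : (Fin 1 → G) → augIdeal G := fun g =>
  ⟨MonoidAlgebra.single (g 0) 1 - MonoidAlgebra.single 1 1, by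
    simp [LinearMap.mem_ker, augmentation_single]⟩

variable {G}

theorem bersteinCochain_mul (g h : G) :
    bersteinCochain G (fun _ => g * h) =
      (augIdeal G).ρ g (bersteinCochain G fun _ => h) + bersteinCochain G (fun _ => g) := by
  apply Subtype.ext
  change MonoidAlgebra.single (g * h) (1 : ℤ) - MonoidAlgebra.single 1 1 =
    (Rep.leftRegular ℤ G).ρ g (MonoidAlgebra.single h 1 - MonoidAlgebra.single 1 1) +
      (MonoidAlgebra.single g 1 - MonoidAlgebra.single 1 1)
  simp [map_sub]

/-- The cup product of inhomogeneous cochains `a ∈ C^p(G; A)`, `b ∈ C^q(G; B)`, with values in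
`A ⊗ B` with the diagonal action:
`(a ∪ b)(g₁, …, g_{p+q}) = a(g₁, …, g_p) ⊗ (g₁⋯g_p) • b(g_{p+1}, …, g_{p+q})`. -/
def cup {k : Type} [CommRing k] {A B : Rep.{0} k G} {p q : ℕ} (a : (Fin p → G) → A)
    (b : (Fin q → G) → B) : (Fin (p + q) → G) → (A ⊗ B : Rep.{0} k G) := fun g =>
  TensorProduct.tmul k (a fun i => g (Fin.castAdd q i))
    (B.ρ (Fin.partialProd (fun i => g (Fin.castAdd q i)) (Fin.last p))
      (b fun j => g (Fin.natAdd p j)))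

theorem partialProd_castSucc {p : ℕ} (x : Fin (p + 1) → G) (j : Fin (p + 1)) :
    Fin.partialProd (fun i : Fin p => x i.castSucc) j = Fin.partialProd x j.castSucc := by
  induction j using Fin.induction with
  | zero => simp
  | succ i ih =>
    rw [Fin.partialProd_succ, ih, ← Fin.succ_castSucc, Fin.partialProd_succ]

/-- The cup product of a `p`-cocycle and a `1`-cocycle is a cocycle. -/
theorem d_cup {k : Type} [CommRing k] {A B : Rep.{0} k G} {p : ℕ} (a : (Fin p → G) → A)
    (b : (Fin 1 → G) → B) (ha : inhomogeneousCochains.d A p a = 0)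
    (hb : ∀ g h : G, b (fun _ => g * h) = B.ρ g (b fun _ => h) + b (fun _ => g)) :
    inhomogeneousCochains.d (A ⊗ B) (p + 1) (cup a b) = 0 := by
  have hb' : ∀ x : Fin 1 → G, b x = b (fun _ => x 0) := fun x => by
    congr 1; ext i; rw [Subsingleton.elim i 0]
  have hcup : ∀ x : Fin (p + 1) → G, cup a b x = TensorProduct.tmul k (a fun i => x i.castSucc)
      (B.ρ (Fin.partialProd x (Fin.last p).castSucc) (b fun _ => x (Fin.last p))) := by
    intro x
    unfold cup
    rw [hb', ← partialProd_castSucc]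
    rfl
  ext g
  have ha' := congrFun ha (fun i => g (Fin.castSucc i))
  rw [inhomogeneousCochains.d_hom_apply, Fin.sum_univ_castSucc] at ha'
  rw [inhomogeneousCochains.d_hom_apply, Fin.sum_univ_castSucc, Fin.sum_univ_castSucc]
  set T := B.ρ (Fin.partialProd g (Fin.last (p + 1)).castSucc) (b fun _ => g (Fin.last (p + 1)))
    with hT
  have h0 : (A ⊗ B).ρ (g 0) (cup a b fun i => g i.succ) =
      TensorProduct.tmul k (A.ρ (g 0) (a fun i => g i.succ.castSucc)) T := by
    rw [hcup]
    change TensorProduct.tmul k _ (B.ρ _ (B.ρ _ _)) = _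
    rw [← Module.End.mul_apply, ← map_mul, hT]
    congr 3
    rw [← Fin.succ_last, ← Fin.succ_castSucc, Fin.partialProd_succ']
    rfl
  have h1 : ∀ j : Fin p, cup a b (Fin.contractNth j.castSucc.castSucc (· * ·) g) =
      TensorProduct.tmul k (a (Fin.contractNth j.castSucc (· * ·) fun i => g i.castSucc)) T := by
    intro j
    rw [hcup, hT, Fin.partialProd_contractNth, Fin.contractNth_apply_of_gt _ _ _ _ (by simp)]
    congr 3
    simp only [Function.comp_apply]
    congr 2
    rw [Fin.succAbove_of_le_castSucc]
    · rfl
    · simp [Fin.le_def]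
  have h2 : cup a b (Fin.contractNth (Fin.last p).castSucc (· * ·) g) =
      TensorProduct.tmul k (a fun i => g i.castSucc.castSucc) (T +
        B.ρ (Fin.partialProd g (Fin.last p).castSucc.castSucc)
          (b fun _ => g (Fin.last p).castSucc)) := by
    rw [hcup, Fin.contractNth_apply_of_eq _ _ _ _ (by simp), hb, map_add, hT,
      ← Module.End.mul_apply, ← map_mul]
    have e : Fin.partialProd (Fin.contractNth (Fin.last p).castSucc (· * ·) g)
        (Fin.last p).castSucc = Fin.partialProd g (Fin.last p).castSucc.castSucc := by
      rw [Fin.partialProd_contractNth, Function.comp_apply, Fin.succAbove_of_castSucc_lt]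
      simp [Fin.lt_def]
    rw [e, ← Fin.partialProd_succ, Fin.succ_castSucc, Fin.succ_last]
    congr 2
    ext i
    rw [Fin.contractNth_apply_of_lt _ _ _ _ (by simp)]
  have h3 : cup a b (Fin.contractNth (Fin.last (p + 1)) (· * ·) g) =
      TensorProduct.tmul k (a fun i => g i.castSucc.castSucc)
        (B.ρ (Fin.partialProd g (Fin.last p).castSucc.castSucc)
          (b fun _ => g (Fin.last p).castSucc)) := by
    have : Fin.contractNth (Fin.last (p + 1)) (· * ·) g = fun i => g i.castSucc := by
      ext i
      rw [Fin.contractNth_apply_of_lt _ _ _ _ (by simp; omega)]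
    rw [hcup, this, partialProd_castSucc]
  have h4 : Fin.contractNth (Fin.last p) (· * ·) (fun i => g (Fin.castSucc i)) =
      fun i => g i.castSucc.castSucc := by
    ext i
    rw [Fin.contractNth_apply_of_lt _ _ _ _ (by simp)]
  rw [h0, h2, h3]
  simp only [h1]
  rw [h4] at ha'
  simp only [TensorProduct.tmul_add]
  have key := congrArg (fun y : A => TensorProduct.tmul k y T) ha'
  simp only [TensorProduct.add_tmul, TensorProduct.sum_tmul, ← TensorProduct.smul_tmul'] at key
  have e : ∀ z : TensorProduct k A B, (-1 : k) ^ (p + 1 + 1) • z = -((-1 : k) ^ (p + 1) • z) := by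
    intro z
    rw [pow_succ, mul_neg_one, neg_smul]
  have aux : ∀ x s u w : TensorProduct k A B,
      x + (s + u) = 0 → x + (s + (u + w) + -w) = 0 := by
    intro x s u w h
    rw [← h]
    abel
  rw [Pi.zero_apply, TensorProduct.zero_tmul] at key
  simp only [Fin.val_castSucc, Fin.val_last, Fin.castSucc_zero, smul_add] at key ⊢
  exact (congrArg _ (congrArg _ (e _))).trans (aux _ _ _ _ key)

variable (G)

/-- The iterated tensor power `I(G)^{⊗ k}` with the diagonal action; `I(G)^{⊗ 0} = ℤ`. -/
def augPow : ℕ → Rep.{0} ℤ G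
  | 0 => Rep.trivial ℤ G ℤ
  | k + 1 => augPow k ⊗ augIdeal G

/-- The cocycle representing the `k`-fold cup power of the Berstein–Schwarz class. -/
def bersteinPowCochain : (k : ℕ) → (Fin k → G) → augPow G k
  | 0 => fun _ => (1 : ℤ)
  | k + 1 => cup (bersteinPowCochain k) (bersteinCochain G)

theorem d_bersteinPowCochain (k : ℕ) :
    inhomogeneousCochains.d (augPow G k) k (bersteinPowCochain G k) = 0 := by
  induction k with
  | zero =>
    ext g
    rw [inhomogeneousCochains.d_hom_apply, Fin.sum_univ_one]
    change (1 : ℤ) + (-1 : ℤ) ^ (0 + 1) • (1 : ℤ) = 0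
    norm_num
  | succ k ih => exact d_cup _ _ ih bersteinCochain_mul

/-- The `k`-th cup power `β_G^k ∈ H^k(G; I(G)^{⊗ k})` of the Berstein–Schwarz class of `G`. -/
def bersteinPow (k : ℕ) : groupCohomology (augPow G k) k :=
  groupCohomology.π (augPow G k) k
    (groupCohomology.cocyclesMk (bersteinPowCochain G k) (d_bersteinPowCochain G k))

variable {G}

/-- The pullback `f^* β_H^k ∈ H^k(G; f^* I(H)^{⊗ k})` along a homomorphism `f : G → H`. -/
def pullbackBersteinPow {H : Type} [Group H] (f : G →* H) (k : ℕ) :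
    groupCohomology (Rep.res f (augPow H k)) k :=
  groupCohomology.map f (𝟙 (Rep.res f (augPow H k))) k (bersteinPow H k)

end Berstein

end HomCat

end

noncomputable section

namespace HomCat

open Topology

/-! ### Equivariant maps into contractible spaces -/

section Equivariant

/-! By Smith normal form, with `r` the rank, `f` factors through `ℤ^r`, and there are homomorphisms
`s : ℤ^r → ℤ^n` and `π : ℤ^m → ℤ^r` for which `π ∘ f ∘ s` is diagonal with nonzero entries
(`exists_diagonalization`). The factorization gives all upper bounds, the diagonal map all lower
bounds.

The topology is done with equivariant maps between universal coverings:
`Numeration.exists_equivariant` builds maps into contractible spaces, and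
`Induces.exists_equivariant_lift` lifts `Bf` to an equivariant `ψ : E → F`. For `TC ≤ r`
(`TCLE_of_equivariant`), take an equivariant `a : E → ℝ^r`. The difference `a e₀ - a e₁` lies in one
of `r + 1` invariant open sets, each a disjoint union of open unit cells. Its cell selects a
translate of `ψ e₁`, which is joined to `ψ e₀` inside the contractible `F`. Since the groups are
commutative, the projected path depends only on the images of `e₀` and `e₁` in `X`.

For `r ≤ cat` (`le_of_catLE`), a null-homotopy on each of `k + 1` open sets lifts `φ` there;
comparing this lift with `ψ` gives locally constant equivariant maps to `ℝ^r` on `k + 1` invariant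
open sets covering `ℝ^r`. Gluing them by an invariant partition of unity yields a `C¹` map `h` that
commutes with the lattice. As the differentials of the partition functions sum to zero, the
derivative of `h` has rank at most `k` everywhere. It is invertible somewhere
(`exists_det_fderiv_ne_zero`): the integral of `det (1 + t D(h - id))` over a unit cell is a
polynomial in `t` which equals the volume of the cell for small `t > 0`, hence also for `t = 1`.

In cohomology, powers above `r` vanish because they are pulled back from `ℤ^r`, whose cohomological
dimension is at most `r` (`isZero_groupCohomology_lattice`). The `r`-th power is detected by
applying an invariant functional and antisymmetrizing: coboundaries go to zero, while the power goes
to the product of the diagonal entries (`pullbackBersteinPow_ne_zero`). -/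

/-- A numeration of the action `ρ` of `G` on `E`: a locally finite family of invariant bump
functions `t i` together with equivariant locally constant maps `z i` to `G`, defined near the
closed support of `t i`. -/
structure Numeration {G : Type*} [Group G] {E : Type*} [TopologicalSpace E]
    (ρ : G →* (E ≃ₜ E)) (ι : Type*) where
  t : ι → C(E, I)
  z : ι → E → G
  locallyFinite : LocallyFinite fun i => {e | t i e ≠ 0}
  exists_eq_one : ∀ e, ∃ i, t i e = 1
  t_act : ∀ i g e, t i (ρ g e) = t i e
  z_locConst : ∀ i, ∀ e ∈ closure {e | t i e ≠ 0}, ∀ᶠ e' in 𝓝 e, z i e' = z i e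
  z_act : ∀ i g e, t i e ≠ 0 → z i (ρ g e) = g * z i e

variable {G H : Type*} [Group G] [Group H] {E F : Type*} [TopologicalSpace E]
  [TopologicalSpace F] {ρ : G →* (E ≃ₜ E)} {ι : Type*}

namespace Numeration

variable (N : Numeration ρ ι) (τ : H →* (F ≃ₜ F)) (f : G →* H) (c : C(I × F, F))

/-- Contract `y` towards the translate of the centre of contraction by `f (z i e)`,
up to time `s * t i e`. -/
def push (i : ι) (x : I × E) (y : F) : F :=
  τ (f (N.z i x.2)) (c (x.1 * N.t i x.2, (τ (f (N.z i x.2)))⁻¹ y))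

variable {c} (hc0 : ∀ y, c (0, y) = y) (hc1 : ∀ y y', c (1, y) = c (1, y'))

include hc0 in
theorem push_of_mul_eq_zero {i : ι} {x : I × E} (h : x.1 * N.t i x.2 = 0) (y : F) :
    N.push τ f c i x y = y := by
  rw [push, h, hc0]
  exact (τ (f (N.z i x.2))).apply_symm_apply y

include hc1 in
theorem push_one {i : ι} {e : E} (h : N.t i e = 1) (y y' : F) :
    N.push τ f c i (1, e) y = N.push τ f c i (1, e) y' := by
  simp only [push, h, mul_one]
  rw [hc1]

-- Conjugating the contraction by `f (z i e)` turns equivariance of `z i` into equivariance of the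
-- push. Where `t i` vanishes nothing is known about `z i`, but there the push is the identity.
include hc0 in
theorem push_act (i : ι) (s : I) (g : G) (e : E) (y : F) :
    N.push τ f c i (s, ρ g e) (τ (f g) y) = τ (f g) (N.push τ f c i (s, e) y) := by
  by_cases h : N.t i e = 0
  · rw [N.push_of_mul_eq_zero τ f hc0, N.push_of_mul_eq_zero τ f hc0]
    · simp [h]
    · simp [N.t_act, h]
  · simp only [push, N.t_act, N.z_act i g e h, map_mul, mul_inv_rev]
    change τ (f g) (τ (f (N.z i e)) (c (_, (τ (f (N.z i e)))⁻¹ ((τ (f g)).symm (τ (f g) y))))) = _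
    rw [Homeomorph.symm_apply_apply]

-- Local constancy of `z i` is available only on the closed support of `t i`. Off that closed set
-- the push is locally the identity, so the two local formulas cover everything.
include hc0 in
theorem continuous_push (i : ι) :
    Continuous fun x : (I × E) × F => N.push τ f c i x.1 x.2 := by
  rw [continuous_iff_continuousAt]
  rintro ⟨⟨s, e⟩, y⟩
  have he : Filter.Tendsto (fun x : (I × E) × F => x.1.2) (𝓝 ((s, e), y)) (𝓝 e) :=
    (continuous_snd.comp continuous_fst).tendsto _
  by_cases h : e ∈ closure {e | N.t i e ≠ 0}
  · have h1 : (fun x : (I × E) × F => N.push τ f c i x.1 x.2) =ᶠ[𝓝 ((s, e), y)]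
        fun x => τ (f (N.z i e)) (c (x.1.1 * N.t i x.1.2, (τ (f (N.z i e))).symm x.2)) := by
      filter_upwards [he.eventually (N.z_locConst i e h)] with x hx
      simp only [push, hx]
      rfl
    refine ContinuousAt.congr ?_ h1.symm
    have := (τ (f (N.z i e))).continuous
    have := (τ (f (N.z i e))).symm.continuous
    fun_prop
  · have h1 : (fun x : (I × E) × F => N.push τ f c i x.1 x.2) =ᶠ[𝓝 ((s, e), y)]
        fun x => x.2 := by
      filter_upwards [he.eventually (isClosed_closure.isOpen_compl.mem_nhds h)] with x hx
      have : N.t i x.1.2 = 0 := by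
        by_contra h'
        exact hx (subset_closure h')
      exact N.push_of_mul_eq_zero τ f hc0 (by simp [this]) _
    exact continuous_snd.continuousAt.congr h1.symm

variable (c) in
/-- The composite of the maps `push i` for `i` in a list. -/
def pushList (l : List ι) (x : I × E) (y : F) : F :=
  l.foldl (fun y i => N.push τ f c i x y) y

include hc0 in
theorem continuous_pushList (l : List ι) :
    Continuous fun x : (I × E) × F => N.pushList τ f c l x.1 x.2 := by
  induction l with
  | nil => exact continuous_snd
  | cons i l ih =>
    exact ih.comp (continuous_fst.prodMk (N.continuous_push τ f hc0 i))

include hc0 in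
theorem pushList_filter (l : List ι) (P : ι → Prop) [DecidablePred P] (x : I × E)
    (h : ∀ i, ¬ P i → N.t i x.2 = 0) (y : F) :
    N.pushList τ f c (l.filter P) x y = N.pushList τ f c l x y := by
  induction l generalizing y with
  | nil => rfl
  | cons i l ih =>
    by_cases hi : P i
    · rw [List.filter_cons_of_pos (by simpa using hi)]
      exact ih _
    · rw [List.filter_cons_of_neg (by simpa using hi), ih]
      change _ = N.pushList τ f c l x (N.push τ f c i x y)
      rw [N.push_of_mul_eq_zero τ f hc0 (by simp [h i hi])]

include hc0 in
theorem pushList_zero (l : List ι) (e : E) (y : F) : N.pushList τ f c l (0, e) y = y := by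
  induction l generalizing y with
  | nil => rfl
  | cons i l ih =>
    change N.pushList τ f c l (0, e) (N.push τ f c i (0, e) y) = y
    rw [ih, N.push_of_mul_eq_zero τ f hc0 (by simp)]

include hc1 in
theorem pushList_one {l : List ι} {e : E} {i : ι} (hi : i ∈ l) (h : N.t i e = 1) (y y' : F) :
    N.pushList τ f c l (1, e) y = N.pushList τ f c l (1, e) y' := by
  induction l generalizing y y' with
  | nil => simp at hi
  | cons j l ih =>
    change N.pushList τ f c l (1, e) (N.push τ f c j (1, e) y) =
      N.pushList τ f c l (1, e) (N.push τ f c j (1, e) y')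
    rcases List.mem_cons.1 hi with rfl | hi
    · rw [N.push_one τ f hc1 h y y']
    · exact ih hi _ _

include hc0 in
theorem pushList_act (l : List ι) (s : I) (g : G) (e : E) (y : F) :
    N.pushList τ f c l (s, ρ g e) (τ (f g) y) = τ (f g) (N.pushList τ f c l (s, e) y) := by
  induction l generalizing y with
  | nil => rfl
  | cons i l ih =>
    change N.pushList τ f c l (s, ρ g e) (N.push τ f c i (s, ρ g e) (τ (f g) y)) = _
    rw [N.push_act τ f hc0, ih]
    rfl

end Numeration

/-- Over a numerable action on `E`, the identity of a contractible `H`-space `F` can be deformed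
equivariantly, with parameters in `E`, to a map which does not depend on the point of `F`. -/
theorem Numeration.exists_contraction (N : Numeration ρ ι) (τ : H →* (F ≃ₜ F)) (f : G →* H)
    [ContractibleSpace F] :
    ∃ Φ : I × E → F → F, (Continuous fun x : (I × E) × F => Φ x.1 x.2) ∧
      (∀ e y, Φ (0, e) y = y) ∧ (∀ e y y', Φ (1, e) y = Φ (1, e) y') ∧
      ∀ s g e y, Φ (s, ρ g e) (τ (f g) y) = τ (f g) (Φ (s, e) y) := by
  classical
  obtain ⟨y₀, ⟨h⟩⟩ := id_nullhomotopic F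
  set c : C(I × F, F) := h.toContinuousMap with hc
  have hc0 : ∀ y, c (0, y) = y := fun y => h.apply_zero y
  have hc1 : ∀ y y', c (1, y) = c (1, y') := fun y y' =>
    (h.apply_one y).trans (h.apply_one y').symm
  -- Any total order works: it makes the order of composition of the active pushes consistent from
  -- point to point.
  let _ : LinearOrder ι := linearOrderOfSTO WellOrderingRel
  let act : E → Finset ι := fun e => (N.locallyFinite.point_finite e).toFinset
  have mem_act : ∀ e i, i ∈ act e ↔ N.t i e ≠ 0 := fun e i => by simp [act]
  refine ⟨fun x y => N.pushList τ f c (act x.2).sort x y, ?_, fun e y => ?_, fun e y y' => ?_,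
    fun s g e y => ?_⟩
  · rw [continuous_iff_continuousAt]
    rintro ⟨⟨s, e⟩, y⟩
    obtain ⟨U, hU, hf⟩ := N.locallyFinite e
    have he : Filter.Tendsto (fun x : (I × E) × F => x.1.2) (𝓝 ((s, e), y)) (𝓝 e) :=
      (continuous_snd.comp continuous_fst).tendsto _
    refine (N.continuous_pushList τ f hc0 (hf.toFinset.sort)).continuousAt.congr ?_
    filter_upwards [he.eventually hU] with x hx
    -- Inactive pushes are identities, so near `e` the varying list of active indices may be
    -- replaced by one fixed finite list, whose composite is continuous.
    have hsub : act x.1.2 = hf.toFinset.filter (fun i => i ∈ act x.1.2) := by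
      ext i
      simp only [Finset.mem_filter, Set.Finite.mem_toFinset, Set.mem_ofPred_eq]
      exact ⟨fun hi => ⟨⟨x.1.2, (mem_act _ _).1 hi, hx⟩, hi⟩, fun hi => hi.2⟩
    have hsort : (act x.1.2).sort = hf.toFinset.sort.filter (fun i => i ∈ act x.1.2) := by
      refine List.Perm.eq_of_sortedLE (Finset.sortedLT_sort _).sortedLE
        ((Finset.sortedLT_sort _).sortedLE.pairwise.filter _).sortedLE ?_
      refine (List.perm_ext_iff_of_nodup (Finset.sort_nodup _ _)
        ((Finset.sort_nodup _ _).filter _)).2 fun i => ?_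
      rw [Finset.mem_sort, hsub]
      simp
    simp only [hsort]
    exact (N.pushList_filter τ f hc0 _ _ _ (fun i hi => by
      by_contra h'; exact hi ((mem_act _ _).2 h')) _).symm
  · exact N.pushList_zero τ f hc0 _ _ _
  · obtain ⟨i, hi⟩ := N.exists_eq_one e
    refine N.pushList_one τ f hc1 (i := i) ?_ hi _ _
    simp [mem_act, hi]
  · have : act (ρ g e) = act e := by
      ext i
      simp [mem_act, N.t_act]
    simp only [this]
    exact N.pushList_act τ f hc0 _ _ _ _ _

/-- A numerable `G`-space maps equivariantly to every contractible space with `G`-action. -/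
theorem Numeration.exists_equivariant (N : Numeration ρ ι) (τ : H →* (F ≃ₜ F)) (f : G →* H)
    [ContractibleSpace F] : ∃ a : C(E, F), ∀ g e, a (ρ g e) = τ (f g) (a e) := by
  obtain ⟨Φ, hΦ, -, h1, h2⟩ := N.exists_contraction τ f
  obtain ⟨y₀⟩ := (inferInstance : Nonempty F)
  refine ⟨⟨fun e => Φ (1, e) y₀, hΦ.comp (by fun_prop : Continuous fun e : E =>
    (((1 : I), e), y₀))⟩, fun g e => ?_⟩
  exact (h1 _ _ _).trans (h2 1 g e y₀)

end Equivariant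

/-! ### Deck groups of covering maps -/

section Deck

/-- `p` is a surjective covering map and `ρ` makes `G` act on `E` by deck transformations, simply
transitively on each fibre. -/
structure IsDeck {G : Type*} [Group G] {E X : Type*} [TopologicalSpace E] [TopologicalSpace X]
    (p : E → X) (ρ : G →* (E ≃ₜ E)) : Prop where
  isCoveringMap : IsCoveringMap p
  surjective : Function.Surjective p
  map_act : ∀ g e, p (ρ g e) = p e
  transitive : ∀ e e', p e = p e' → ∃ g, ρ g e' = e
  free : ∀ g e, ρ g e = e → g = 1

namespace IsDeck

variable {G : Type*} [Group G] {E X T : Type*} [TopologicalSpace E] [TopologicalSpace X]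
  [TopologicalSpace T] {p : E → X} {ρ : G →* (E ≃ₜ E)}

theorem act_injective (h : IsDeck p ρ) {g g' : G} {e : E} (he : ρ g e = ρ g' e) : g = g' := by
  have : ρ (g'⁻¹ * g) e = e := by
    rw [map_mul, map_inv, Homeomorph.mul_apply, he]
    exact (ρ g').symm_apply_apply e
  exact (inv_mul_eq_one.1 (h.free _ _ this)).symm

theorem eventuallyEq_of_lifts (h : IsDeck p ρ) {A B : T → E} {t₀ : T} (hA : ContinuousAt A t₀)
    (hB : ContinuousAt B t₀) (hAB : ∀ᶠ t in 𝓝 t₀, p (A t) = p (B t)) (h₀ : A t₀ = B t₀) :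
    ∀ᶠ t in 𝓝 t₀, A t = B t := by
  obtain ⟨U, hU, hmem, hinj⟩ := h.isCoveringMap.isLocalHomeomorph.isLocallyInjective (A t₀)
  filter_upwards [hA.eventually (hU.mem_nhds hmem), hB.eventually (hU.mem_nhds (h₀ ▸ hmem)), hAB]
    with t h1 h2 h3 using hinj h1 h2 h3

open scoped Classical in
/-- The deck transformation taking `e'` to `e`, if these points lie in the same fibre. -/
def diff (_ : IsDeck p ρ) (e e' : E) : G := if h : ∃ g, ρ g e' = e then h.choose else 1

theorem diff_act_self (h : IsDeck p ρ) {e e' : E} (he : p e = p e') :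
    ρ (h.diff e e') e' = e := by
  have := h.transitive e e' he
  rw [diff, dif_pos this]
  exact this.choose_spec

theorem diff_eq (h : IsDeck p ρ) {e e' : E} {g : G} (hg : ρ g e' = e) : h.diff e e' = g :=
  h.act_injective ((h.diff_act_self (by rw [← hg, h.map_act])).trans hg.symm)

theorem diff_act (h : IsDeck p ρ) {e e' : E} (he : p e = p e') (g : G) :
    h.diff (ρ g e) e' = g * h.diff e e' :=
  h.diff_eq (by rw [map_mul, Homeomorph.mul_apply, h.diff_act_self he])

/-- The deck transformation found at `t₀` makes the two lifts agree at `t₀`; local injectivity of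
the covering makes them agree nearby. -/
theorem eventually_diff_eq (h : IsDeck p ρ) {A B : T → E} {t₀ : T} (hA : ContinuousAt A t₀)
    (hB : ContinuousAt B t₀) (hAB : ∀ᶠ t in 𝓝 t₀, p (A t) = p (B t)) :
    ∀ᶠ t in 𝓝 t₀, h.diff (A t) (B t) = h.diff (A t₀) (B t₀) := by
  have := h.eventuallyEq_of_lifts hA ((ρ (h.diff (A t₀) (B t₀))).continuous.continuousAt.comp hB)
    (hAB.mono fun t ht => by rw [Function.comp_apply, h.map_act, ht])
    (h.diff_act_self hAB.self_of_nhds).symm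
  exact this.mono fun t ht => h.diff_eq ht.symm

theorem exists_section (h : IsDeck p ρ) (x : X) : ∃ (W : Set X) (s : X → E), IsOpen W ∧ x ∈ W ∧
    ContinuousOn s W ∧ ∀ y ∈ W, p (s y) = y := by
  obtain ⟨e, rfl⟩ := h.surjective x
  obtain ⟨φ, he, hφ⟩ := h.isCoveringMap.isLocalHomeomorph e
  refine ⟨φ.target, φ.symm, φ.open_target, ?_, φ.continuousOn_symm, fun y hy => ?_⟩
  · rw [hφ]
    exact φ.map_source he
  · rw [hφ]
    exact φ.right_inv hy

/-- The deck action of a covering space of a paracompact Hausdorff space is numerable. -/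
theorem exists_numeration [T2Space X] [ParacompactSpace X] (h : IsDeck p ρ) :
    Nonempty (Numeration ρ X) := by
  choose W s hW hx hs hps using h.exists_section
  obtain ⟨b, hb⟩ := BumpCovering.exists_isSubordinate (s := Set.univ) isClosed_univ W hW
    (fun x _ => Set.mem_iUnion.2 ⟨x, hx x⟩)
  have hp := h.isCoveringMap.continuous
  let t : X → C(E, I) := fun i =>
    ⟨fun e => ⟨b i (p e), b.nonneg i _, b.le_one i _⟩, by fun_prop⟩
  have ht : ∀ i e, t i e ≠ 0 ↔ b i (p e) ≠ 0 := fun i e => not_congr (by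
    rw [Subtype.ext_iff]
    rfl)
  have hWt : ∀ i, ∀ e ∈ closure {e | t i e ≠ 0}, p e ∈ W i := by
    intro i e he
    refine hb i ?_
    refine closure_mono ?_ (image_closure_subset_closure_image hp ⟨e, he, rfl⟩)
    rintro _ ⟨e', he', rfl⟩
    exact (ht i e').1 he'
  refine ⟨⟨t, fun i e => h.diff e (s i (p e)), ?_, fun e => ?_, fun i g e => ?_, fun i e he => ?_,
    fun i g e he => ?_⟩⟩
  · simp only [ht]
    exact b.locallyFinite.preimage_continuous hp
  · obtain ⟨i, hi⟩ := b.eventuallyEq_one' (p e) trivial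
    exact ⟨i, Subtype.ext hi.self_of_nhds⟩
  · refine Subtype.ext ?_
    change b i (p (ρ g e)) = b i (p e)
    rw [h.map_act]
  · have hpe : W i ∈ 𝓝 (p e) := (hW i).mem_nhds (hWt i e he)
    refine h.eventually_diff_eq continuousAt_id
      (((hs i).continuousAt hpe).comp hp.continuousAt) ?_
    filter_upwards [hp.continuousAt.eventually hpe] with e' he'
    exact (hps i _ he').symm
  · rw [h.map_act, h.diff_act]
    exact (hps i _ (hWt i e (subset_closure he))).symm

end IsDeck

theorem _root_.IsLocalHomeomorph.locallyPathConnectedSpace {E X : Type*} [TopologicalSpace E]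
    [TopologicalSpace X] [LocallyPathConnectedSpace X] {p : E → X} (h : IsLocalHomeomorph p) :
    LocallyPathConnectedSpace E where
  path_connected_basis e := by
    rw [Filter.hasBasis_self]
    intro s hs
    obtain ⟨φ, he, -⟩ := h e
    have := φ.isOpenEmbedding_restrict.locallyPathConnectedSpace
    obtain ⟨t, ⟨ht, htc⟩, hts⟩ := (LocallyPathConnectedSpace.path_connected_basis
      (⟨e, he⟩ : φ.source)).mem_iff.1 (continuous_subtype_val.continuousAt hs)
    exact ⟨Subtype.val '' t, φ.open_source.isOpenMap_subtype_val.image_mem_nhds ht,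
      htc.image continuous_subtype_val, Set.image_subset_iff.2 hts⟩

theorem _root_.IsCoveringMap.surjective {E X : Type*} [TopologicalSpace E] [TopologicalSpace X]
    [PathConnectedSpace X] [Nonempty E] {p : E → X} (h : IsCoveringMap p) :
    Function.Surjective p := by
  intro x
  obtain ⟨e⟩ := (inferInstance : Nonempty E)
  exact ⟨_, (h.monodromy (.mk (PathConnectedSpace.somePath (p e) x)) ⟨e, rfl⟩).2⟩

/-! ### Universal coverings of Eilenberg–MacLane spaces -/

section Existence

variable {G : Type} [Group G] {X : Type u} [TopologicalSpace X]

/-- The universal covering of a `K(G, 1)` with commutative `G` as a contractible `G`-space. -/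
theorem EilenbergMacLane.exists_isDeck (K : EilenbergMacLane G X) (hG : ∀ a b : G, a * b = b * a) :
    ∃ (E : Type u) (_ : TopologicalSpace E) (p : E → X) (ρ : G →* (E ≃ₜ E)) (e₀ : E)
      (h₀ : K.base = p e₀) (h : IsDeck p ρ), ContractibleSpace E ∧ LocallyPathConnectedSpace E ∧
      ∀ g (γ : Path e₀ (ρ g e₀)), K.pi1 (.mk ((γ.map h.isCoveringMap.continuous).cast h₀
        (h₀.trans (h.map_act g e₀).symm))) = g := by
  obtain ⟨E, tE, p, hE, hp⟩ := K.contractible_covering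
  have := K.pathConnected
  have := K.locallyPathConnected
  have : LocallyPathConnectedSpace E := hp.isLocalHomeomorph.locallyPathConnectedSpace
  have hsurj := hp.surjective
  obtain ⟨e₀, h₀⟩ := hsurj K.base
  let D : Subgroup (E ≃ₜ E) :=
    { carrier := {d | ∀ e, p (d e) = p e}
      mul_mem' := fun {a b} ha hb e => (ha _).trans (hb e)
      one_mem' := fun e => rfl
      inv_mem' := fun {a} ha e => by
        rw [← ha (a⁻¹ e)]
        exact congrArg p (a.apply_symm_apply e) }
  let _ : MulAction D E :=
    { smul := fun d e => d.1 e
      one_smul := fun e => rfl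
      mul_smul := fun a b e => rfl }
  have smul_def : ∀ (d : D) (e : E), d • e = d.1 e := fun d e => rfl
  have lift : ∀ e e', p e = p e' → ∃ F : C(E, E), F e' = e ∧ p ∘ F = p := fun e e' he =>
    (hp.existsUnique_continuousMap_lifts ⟨p, hp.continuous⟩ e' e he).exists
  have uniq : ∀ (F F' : C(E, E)) (e : E), p ∘ F = p → p ∘ F' = p → F e = F' e → F = F' :=
    fun F F' e h1 h2 h3 => DFunLike.coe_injective
      (hp.eq_of_comp_eq F.continuous F'.continuous (h1.trans h2.symm) e h3)
  have hq : IsQuotientCoveringMap p D := by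
    refine (isQuotientCoveringMap_iff_isCoveringMap_and p D).2 ⟨hp, hsurj, ⟨fun d => d.1.continuous⟩,
      ⟨fun a b e hab => ?_⟩, fun {e₁ e₂} => ⟨fun he => ?_, ?_⟩⟩
    · have := uniq ⟨a.1, a.1.continuous⟩ ⟨b.1, b.1.continuous⟩ e (funext a.2) (funext b.2) hab
      exact Subtype.ext (Homeomorph.ext fun x => congrArg (fun F : C(E, E) => F x) this)
    · obtain ⟨F, hF, hF'⟩ := lift e₁ e₂ he
      obtain ⟨F₁, hF₁, hF₁'⟩ := lift e₂ e₁ he.symm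
      have h1 : F.comp F₁ = ContinuousMap.id E := uniq _ _ e₁
        (by change (p ∘ F) ∘ F₁ = p; rw [hF', hF₁']) rfl (by simp [hF, hF₁])
      have h2 : F₁.comp F = ContinuousMap.id E := uniq _ _ e₂
        (by change (p ∘ F₁) ∘ F = p; rw [hF₁', hF']) rfl (by simp [hF, hF₁])
      refine ⟨⟨⟨⟨F, F₁, fun x => congrArg (fun F : C(E, E) => F x) h2,
        fun x => congrArg (fun F : C(E, E) => F x) h1⟩, F.continuous, F₁.continuous⟩,
        fun e => congrFun hF' e⟩, hF⟩
    · rintro ⟨d, rfl⟩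
      exact d.2 e₂
  have hopp : ∀ e : E, ∀ d : Dᵐᵒᵖ, d.unop • e = d.unop.1 e := fun _ _ => rfl
  let Θ := hq.fundamentalGroupEquiv ⟨e₀, h₀⟩
  let ρ : G →* (E ≃ₜ E) :=
    { toFun := fun g => (Θ (K.pi1.symm g)).unop.1
      map_one' := by simp
      -- `Θ` lands in the opposite of the deck group; commutativity of `G` turns the resulting
      -- anti-homomorphism into an action.
      map_mul' := fun a b => by
        rw [hG a b, map_mul, map_mul]
        rfl }
  have hρ : ∀ g e, ρ g e = (Θ (K.pi1.symm g)).unop • e := fun g e => rfl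
  have hdeck : IsDeck p ρ :=
    { isCoveringMap := hp
      surjective := hsurj
      map_act := fun g e => (Θ (K.pi1.symm g)).unop.2 e
      transitive := fun e e' he => by
        obtain ⟨d, hd⟩ := hq.apply_eq_iff_mem_orbit.1 he
        refine ⟨K.pi1 (Θ.symm (MulOpposite.op d)), ?_⟩
        rw [hρ]
        simpa using hd
      free := fun g e hg => by
        have := hq.isCancelSMul
        have : (Θ (K.pi1.symm g)).unop = 1 := IsCancelSMul.right_cancel _ _ e (by
          rw [one_smul]; exact hg)
        have := MulOpposite.unop_injective (this.trans MulOpposite.unop_one.symm)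
        exact (MulEquiv.map_eq_one_iff K.pi1.symm).1 ((MulEquiv.map_eq_one_iff Θ).1 this) }
  refine ⟨E, tE, p, ρ, e₀, h₀.symm, hdeck, hE, inferInstance, fun g γ => ?_⟩
  set ω : FundamentalGroup X K.base := .mk ((γ.map hp.continuous).cast h₀.symm
        (h₀.symm.trans (hdeck.map_act g e₀).symm)) with hω
  have hm : hp.monodromy ω ⟨e₀, h₀⟩ = ⟨ρ g e₀, (hdeck.map_act g e₀).trans h₀⟩ :=
    hp.monodromy_eq_of_map_eq (.mk γ) rfl
  have h1 : ∀ ω' : FundamentalGroup X K.base, (Θ ω').unop • e₀ = hp.monodromy ω' ⟨e₀, h₀⟩ :=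
    fun ω' => hq.unop_fundamentalGroupToMulOpposite_smul (e := ⟨e₀, h₀⟩)
  have h2 : ρ (K.pi1 ω) e₀ = ρ g e₀ := by
    rw [hρ, MulEquiv.symm_apply_apply, h1, hm]
  exact hdeck.act_injective h2

end Existence

end Deck

/-! ### Equivariant lifts of `Bf` -/

section Lift

variable {G H : Type} [Group G] [Group H] {X : Type u} {Y : Type v} [TopologicalSpace X]
  [TopologicalSpace Y]

/-- A map `Bf` between Eilenberg–MacLane spaces of commutative groups lifts to an `f`-equivariant
map between their universal coverings. -/
theorem Induces.exists_equivariant_lift {KX : EilenbergMacLane G X} {KY : EilenbergMacLane H Y}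
    {φ : C(X, Y)} {f : G →* H} (hφ : Induces KX KY φ f) (hG : ∀ a b : G, a * b = b * a)
    (hH : ∀ a b : H, a * b = b * a) :
    ∃ (E : Type u) (_ : TopologicalSpace E) (p : E → X) (ρ : G →* (E ≃ₜ E))
      (F : Type v) (_ : TopologicalSpace F) (q : F → Y) (τ : H →* (F ≃ₜ F)) (ψ : C(E, F)),
      IsDeck p ρ ∧ ContractibleSpace E ∧ IsDeck q τ ∧ ContractibleSpace F ∧
      (∀ e, q (ψ e) = φ (p e)) ∧ ∀ g e, ψ (ρ g e) = τ (f g) (ψ e) := by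
  obtain ⟨E, tE, p, ρ, e₀, he₀, hE, cE, lE, hπE⟩ := KX.exists_isDeck hG
  obtain ⟨F, tF, q, τ, f₀, hf₀, hF, cF, lF, hπF⟩ := KY.exists_isDeck hH
  obtain ⟨hb, hφ⟩ := hφ
  have hp := hE.isCoveringMap
  have hq := hF.isCoveringMap
  obtain ⟨ψ, hψ₀, hψ⟩ := (hq.existsUnique_continuousMap_lifts (φ.comp ⟨p, hp.continuous⟩) e₀ f₀
    (by rw [← hf₀, ← hb, he₀]; rfl)).exists
  have hψ' : ∀ e, q (ψ e) = φ (p e) := fun e => congrFun hψ e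
  refine ⟨E, tE, p, ρ, F, tF, q, τ, ψ, hE, cE, hF, cF, hψ', fun g e => ?_⟩
  refine congrFun (hq.eq_of_comp_eq (ψ.continuous.comp (ρ g).continuous)
    ((τ (f g)).continuous.comp ψ.continuous) ?_ e₀ ?_) e
  · funext e
    simp only [Function.comp_apply, hF.map_act, hψ', hE.map_act]
  -- Lifts agree once they agree at `e₀`. There they differ by the class of the projection of `ψ ∘
  -- γ`, which is the image under `Bf` of the loop representing `g`.
  · obtain ⟨h, hh⟩ := hF.transitive (ψ (ρ g e₀)) f₀
      (by rw [hψ', hE.map_act, ← hψ', hψ₀])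
    let γ : Path e₀ (ρ g e₀) := PathConnectedSpace.somePath _ _
    have h1 := hπF h ((γ.map ψ.continuous).cast hψ₀.symm hh)
    have h2 := hφ (.mk ((γ.map hp.continuous).cast he₀ (he₀.trans (hE.map_act g e₀).symm)))
    rw [hπE] at h2
    have h3 : h = f g := by
      rw [← h1, ← h2, FundamentalGroup.mapOfEq_apply]
      refine congrArg KY.pi1 ?_
      refine congrArg Path.Homotopic.Quotient.mk ?_
      ext s
      exact hψ' _
    simp only [Function.comp_apply, hψ₀]
    rw [← hh, h3]

end Lift

/-! ### Euclidean space with the action of the integer lattice -/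

section Lattice

variable {r : ℕ}

variable (r) in
/-- The action of `ℤ^r` on `ℝ^r` by translations. -/
def latticeAct : Multiplicative (Fin r → ℤ) →* ((Fin r → ℝ) ≃ₜ (Fin r → ℝ)) where
  toFun w := Homeomorph.addLeft fun l => ((w.toAdd l : ℤ) : ℝ)
  map_one' := by
    ext x l
    simp
  map_mul' a b := by
    ext x l
    simp [add_assoc]

theorem latticeAct_apply (w : Multiplicative (Fin r → ℤ)) (x : Fin r → ℝ) (l : Fin r) :
    latticeAct r w x l = x l + (w.toAdd l : ℤ) := by
  simp [latticeAct, add_comm]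

/-- The set of points of `ℝ^r` no coordinate of which is congruent to `i / (r + 1)` modulo `1`. -/
def offGrid (i : Fin (r + 1)) : Set (Fin r → ℝ) :=
  {x | ∀ l, ∀ k : ℤ, x l - (i : ℝ) / (r + 1) ≠ k}

/-- The translation of the open unit cells which make up `offGrid i`. -/
def cell (i : Fin (r + 1)) (x : Fin r → ℝ) : Multiplicative (Fin r → ℤ) :=
  Multiplicative.ofAdd fun l => ⌊x l - (i : ℝ) / (r + 1)⌋

theorem isOpen_offGrid (i : Fin (r + 1)) : IsOpen (offGrid i) := by
  have : offGrid i = ⋂ l, (fun x : Fin r → ℝ => x l - (i : ℝ) / (r + 1)) ⁻¹'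
      (Set.range ((↑) : ℤ → ℝ))ᶜ := by
    ext x
    simp [offGrid, eq_comm]
  rw [this]
  exact isOpen_iInter_of_finite fun l => Int.isClosedEmbedding_coe_real.isClosed_range.isOpen_compl.preimage
    (by fun_prop)

/-- Pigeonhole: a point outside all `r + 1` sets would have one of its `r` coordinates congruent
modulo `1` to two different fractions `i / (r + 1)`. -/
theorem exists_mem_offGrid (x : Fin r → ℝ) : ∃ i, x ∈ offGrid i := by
  by_contra! h
  simp only [offGrid, Set.mem_ofPred_eq, not_forall, not_not] at h
  choose l k hk using h
  obtain ⟨i, j, hij, hl⟩ := Fintype.exists_ne_map_eq_of_card_lt l (by simp)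
  refine hij (Fin.ext ?_)
  have h1 := hk i
  have h2 := hk j
  rw [hl] at h1
  have hr : (0 : ℝ) < r + 1 := by positivity
  have h3 : (i : ℝ) - j = (k j - k i) * (r + 1) := by
    field_simp at h1 h2
    linarith
  have h4 : ((i : ℕ) : ℤ) - (j : ℕ) = (k j - k i) * ((r : ℤ) + 1) := by exact_mod_cast h3
  have h5 : ((i : ℕ) : ℤ) - (j : ℕ) = 0 := by
    refine Int.eq_zero_of_abs_lt_dvd (m := (r : ℤ) + 1) ⟨_, h4.trans (mul_comm _ _)⟩ ?_
    rw [abs_lt]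
    have := i.2
    have := j.2
    constructor <;> omega
  omega

theorem latticeAct_mem_offGrid (i : Fin (r + 1)) (w : Multiplicative (Fin r → ℤ))
    {x : Fin r → ℝ} (hx : x ∈ offGrid i) : latticeAct r w x ∈ offGrid i := by
  intro l k h
  refine hx l (k - w.toAdd l) ?_
  rw [latticeAct_apply] at h
  push_cast
  linarith

theorem cell_latticeAct (i : Fin (r + 1)) (w : Multiplicative (Fin r → ℤ)) (x : Fin r → ℝ) :
    cell i (latticeAct r w x) = w * cell i x := by
  refine Multiplicative.toAdd.injective (funext fun l => ?_)
  simp only [cell, latticeAct_apply, toAdd_mul, toAdd_ofAdd, Pi.add_apply]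
  rw [add_sub_right_comm, Int.floor_add_intCast, add_comm]

theorem eventually_cell_eq {i : Fin (r + 1)} {x : Fin r → ℝ} (hx : x ∈ offGrid i) :
    ∀ᶠ y in 𝓝 x, cell i y = cell i x := by
  have : ∀ l, ∀ᶠ y : Fin r → ℝ in 𝓝 x,
      ⌊y l - (i : ℝ) / (r + 1)⌋ = ⌊x l - (i : ℝ) / (r + 1)⌋ := by
    intro l
    have hc : ContinuousAt (fun y : Fin r → ℝ => y l - (i : ℝ) / (r + 1)) x :=
      ((continuous_apply l).sub continuous_const).continuousAt
    filter_upwards [hc.eventually (Ioo_mem_nhds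
      (lt_of_le_of_ne (Int.floor_le _) (hx l _).symm) (Int.lt_floor_add_one _))] with y hy
    exact Int.floor_eq_iff.2 ⟨hy.1.le, hy.2⟩
  filter_upwards [Filter.eventually_all.2 this] with y hy
  exact congrArg Multiplicative.ofAdd (funext hy)

end Lattice

/-! ### The upper bound for the topological complexity -/

section UpperBound

/-- Freezing the first endpoint at `x₀` turns a motion planner into a homotopy from the constant map
at `φ x₀` to `φ`. -/
theorem catLE_of_TCLE {X : Type u} {Y : Type v} [TopologicalSpace X] [TopologicalSpace Y]
    [Nonempty X] {φ : C(X, Y)} {k : ℕ} (h : TCLE φ k) : CatLE φ k := by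
  obtain ⟨U, hU, hcov, hs⟩ := h
  obtain ⟨x₀⟩ := (inferInstance : Nonempty X)
  have hc : Continuous fun x : X => (x₀, x) := by fun_prop
  refine ⟨fun i => (fun x => (x₀, x)) ⁻¹' U i, fun i => (hU i).preimage hc, ?_, fun i => ?_⟩
  · rw [← Set.preimage_iUnion, hcov, Set.preimage_univ]
  · obtain ⟨s, hs⟩ := hs i
    refine ⟨φ x₀, ContinuousMap.Homotopic.symm ⟨⟨⟨fun x => s ⟨(x₀, x.2.1), x.2.2⟩ x.1, ?_⟩,
      fun x => (hs _).1, fun x => (hs _).2⟩⟩⟩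
    fun_prop

theorem cat_le_TC {X : Type u} {Y : Type v} [TopologicalSpace X] [TopologicalSpace Y]
    [Nonempty X] (φ : C(X, Y)) : cat φ ≤ TC φ :=
  le_iInf₂ fun k hk => iInf₂_le k (catLE_of_TCLE hk)

variable {G H : Type} [Group G] [Group H] {X : Type u} {Y : Type v} [TopologicalSpace X]
  [TopologicalSpace Y] {E : Type u} [TopologicalSpace E] {F : Type v} [TopologicalSpace F]

theorem TCLE_of_equivariant {p : E → X} {ρ : G →* (E ≃ₜ E)} {q : F → Y} {τ : H →* (F ≃ₜ F)}
    {φ : C(X, Y)} {ψ : C(E, F)} {f : G →* H} [T2Space X] [ParacompactSpace X]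
    [ContractibleSpace F] (hE : IsDeck p ρ) (hF : IsDeck q τ) (hψ : ∀ e, q (ψ e) = φ (p e))
    (hψf : ∀ g e, ψ (ρ g e) = τ (f g) (ψ e)) (hH : ∀ a b : H, a * b = b * a) {r : ℕ}
    (f' : G →* Multiplicative (Fin r → ℤ)) (j : Multiplicative (Fin r → ℤ) →* H)
    (hf : ∀ g, j (f' g) = f g) : TCLE φ r := by
  obtain ⟨N⟩ := hE.exists_numeration
  obtain ⟨a, ha⟩ := N.exists_equivariant (latticeAct r) f'
  obtain ⟨Φ, hΦ, hΦ0, hΦ1, hΦa⟩ := N.exists_contraction τ f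
  have hp := hE.isCoveringMap
  have hpp : IsOpenQuotientMap (Prod.map p p) :=
    IsOpenQuotientMap.prodMap ⟨hE.surjective, hp.continuous, hp.isOpenMap⟩
      ⟨hE.surjective, hp.continuous, hp.isOpenMap⟩
  have hact : ∀ g₀ g₁ e₀ e₁, a (ρ g₀ e₀) - a (ρ g₁ e₁) =
      latticeAct r (f' g₀ * (f' g₁)⁻¹) (a e₀ - a e₁) := by
    intro g₀ g₁ e₀ e₁
    funext l
    simp only [ha, Pi.sub_apply, latticeAct_apply, toAdd_mul, toAdd_inv, Pi.add_apply,
      Pi.neg_apply]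
    push_cast
    ring
  let V : Fin (r + 1) → Set (E × E) := fun i => {e | a e.1 - a e.2 ∈ offGrid i}
  have hV : ∀ i, IsOpen (V i) := fun i => (isOpen_offGrid i).preimage (by fun_prop)
  have hVU : ∀ i, Prod.map p p ⁻¹' (Prod.map p p '' V i) = V i := by
    intro i
    refine Set.Subset.antisymm ?_ (Set.subset_preimage_image _ _)
    rintro ⟨e₀, e₁⟩ ⟨⟨e₀', e₁'⟩, he', he⟩
    obtain ⟨g₀, rfl⟩ := hE.transitive _ _ (congrArg Prod.fst he).symm
    obtain ⟨g₁, rfl⟩ := hE.transitive _ _ (congrArg Prod.snd he).symm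
    change a (ρ g₀ e₀') - a (ρ g₁ e₁') ∈ offGrid i
    rw [hact]
    exact latticeAct_mem_offGrid i _ he'
  refine ⟨fun i => Prod.map p p '' V i, fun i => hpp.isOpenMap _ (hV i), ?_, fun i => ?_⟩
  · refine Set.eq_univ_of_forall fun x => ?_
    obtain ⟨e, rfl⟩ := hpp.surjective x
    obtain ⟨i, hi⟩ := exists_mem_offGrid (a e.1 - a e.2)
    exact Set.mem_iUnion.2 ⟨i, e, hi, rfl⟩
  · set U := Prod.map p p '' V i with hU
    let d : E × E → H := fun e => j (cell i (a e.1 - a e.2))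
    -- The first half contracts `ψ e₀`; the second runs the contraction of the translated `ψ e₁`
    -- backwards. Both use the parameter `e₀`, so they meet in the middle, where `Φ (1, e₀)` ignores
    -- its argument.
    let M : (Prod.map p p ⁻¹' U) × I → F := fun x =>
      if (x.2 : ℝ) ≤ 1 / 2 then
        Φ (Set.projIcc 0 1 zero_le_one (2 * x.2), x.1.1.1) (ψ x.1.1.1)
      else Φ (Set.projIcc 0 1 zero_le_one (2 - 2 * x.2), x.1.1.1) (τ (d x.1) (ψ x.1.1.2))
    have hd : Continuous fun x : (Prod.map p p ⁻¹' U) × I => τ (d x.1) (ψ x.1.1.2) := by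
      rw [continuous_iff_continuousAt]
      rintro ⟨⟨e, he⟩, s⟩
      have he' : a e.1 - a e.2 ∈ offGrid i := (hVU i).le he
      have hc : Continuous fun x : (Prod.map p p ⁻¹' U) × I => a x.1.1.1 - a x.1.1.2 := by
        fun_prop
      refine ContinuousAt.congr (f := fun x : (Prod.map p p ⁻¹' U) × I => τ (d e) (ψ x.1.1.2))
        ?_ ?_
      · have := (τ (d e)).continuous
        fun_prop
      · filter_upwards [hc.continuousAt.eventually (eventually_cell_eq he')] with x hx
        change _ = τ (j (cell i _)) _
        rw [hx]
    have hM : Continuous M := by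
      refine Continuous.if_le ?_ ?_ (by fun_prop) continuous_const ?_
      · exact hΦ.comp (by fun_prop : Continuous fun x : (Prod.map p p ⁻¹' U) × I =>
          ((Set.projIcc (0 : ℝ) 1 zero_le_one (2 * x.2), x.1.1.1), ψ x.1.1.1))
      · exact hΦ.comp ((by fun_prop : Continuous fun x : (Prod.map p p ⁻¹' U) × I =>
          (Set.projIcc (0 : ℝ) 1 zero_le_one (2 - 2 * x.2), x.1.1.1)).prodMk hd)
      · rintro ⟨e, s⟩ hs
        have h1 : Set.projIcc (0 : ℝ) 1 zero_le_one (2 * s) = 1 :=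
          Set.projIcc_of_right_le _ (by simp only at hs; linarith)
        have h2 : Set.projIcc (0 : ℝ) 1 zero_le_one (2 - 2 * s) = 1 :=
          Set.projIcc_of_right_le _ (by simp only at hs; linarith)
        simp only [h1, h2]
        exact hΦ1 _ _ _
    let π : C((Prod.map p p ⁻¹' U) × I, U × I) :=
      ⟨Prod.map (U.restrictPreimage (Prod.map p p)) id,
        (hpp.continuous.restrictPreimage).prodMap continuous_id⟩
    -- Openness of the projection keeps it a quotient map after taking the product with `I`, so `M`
    -- descends before currying.
    have hπ : IsQuotientMap π := by
      refine IsOpenQuotientMap.isQuotientMap ?_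
      refine IsOpenQuotientMap.prodMap ⟨?_, hpp.continuous.restrictPreimage,
        hpp.isOpenMap.restrictPreimage U⟩ IsOpenQuotientMap.id
      exact Set.restrictPreimage_surjective U hpp.surjective
    let m : C((Prod.map p p ⁻¹' U) × I, Y) := ⟨fun x => q (M x), hF.isCoveringMap.continuous.comp hM⟩
    have hfac : Function.FactorsThrough m π := by
      rintro ⟨⟨⟨e₀, e₁⟩, he⟩, s⟩ ⟨⟨⟨e₀', e₁'⟩, he'⟩, s'⟩ h
      obtain rfl : s = s' := congrArg Prod.snd h
      have h' : Prod.map p p (e₀, e₁) = Prod.map p p (e₀', e₁') :=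
        congrArg (fun x : U × I => (x.1 : X × X)) h
      obtain ⟨g₀, rfl⟩ := hE.transitive _ _ (congrArg Prod.fst h')
      obtain ⟨g₁, rfl⟩ := hE.transitive _ _ (congrArg Prod.snd h')
      change q (M _) = q (M _)
      simp only [M]
      split_ifs
      · rw [hψf, hΦa, hF.map_act]
      -- The translation `d` changes by `f g₀ * (f g₁)⁻¹`; commutativity of `H` lets the second
      -- factor cancel against the change of `ψ`.
      · have : τ (d (ρ g₀ e₀', ρ g₁ e₁')) (ψ (ρ g₁ e₁')) =
            τ (f g₀) (τ (d (e₀', e₁')) (ψ e₁')) := by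
          simp only [d]
          rw [hact, cell_latticeAct, hψf, map_mul j, map_mul j, map_inv, hf, hf,
            ← Homeomorph.mul_apply, ← Homeomorph.mul_apply, ← map_mul τ, ← map_mul τ,
            mul_assoc (f g₀), hH (f g₁)⁻¹, mul_assoc, mul_assoc, inv_mul_cancel, mul_one]
        simp only [this]
        rw [hΦa, hF.map_act]
    have hlift : ∀ x, hπ.lift m hfac (π x) = q (M x) := fun x =>
      ContinuousMap.congr_fun (hπ.lift_comp m hfac) x
    refine ⟨(hπ.lift m hfac).curry, ?_⟩
    rintro ⟨x, hx⟩
    obtain ⟨⟨e₀, e₁⟩, rfl⟩ := hpp.surjective x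
    have h0 := hlift (⟨(e₀, e₁), hx⟩, 0)
    have h1 := hlift (⟨(e₀, e₁), hx⟩, 1)
    refine ⟨h0.trans ?_, h1.trans ?_⟩
    · simp [M, hΦ0, hψ]
    · have : ¬ (1 : ℝ) ≤ 1 / 2 := by norm_num
      simp only [M, Set.Icc.coe_one, if_neg this, mul_one, sub_self, Set.projIcc_left]
      exact (congrArg q (hΦ0 _ _)).trans ((hF.map_act _ _).trans (hψ _))

end UpperBound

/-! ### Equivariant self-maps of Euclidean space have somewhere invertible derivative -/

section Degree

open MeasureTheory Module

/-- A polynomial of degree at most `n` is determined linearly by its values at `n + 1` points. -/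
theorem exists_interpolation_weights {n : ℕ} {v : Fin (n + 1) → ℝ} (hv : Function.Injective v)
    (s : ℝ) : ∃ w : Fin (n + 1) → ℝ, ∀ P : Polynomial ℝ, P.natDegree ≤ n →
      P.eval s = ∑ j, w j * P.eval (v j) := by
  refine ⟨fun j => (Lagrange.basis Finset.univ v j).eval s, fun P hP => ?_⟩
  have hdeg : P.degree < (Finset.univ : Finset (Fin (n + 1))).card := by
    rw [Finset.card_univ, Fintype.card_fin]
    exact (Polynomial.degree_le_of_natDegree_le hP).trans_lt (by exact_mod_cast Nat.lt_succ_self n)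
  conv_lhs => rw [Lagrange.eq_interpolate hv.injOn hdeg, Lagrange.interpolate_apply]
  simp [Polynomial.eval_finsetSum, mul_comm]

variable {E : Type*} [NormedAddCommGroup E] [NormedSpace ℝ E] {ι : Type*} [Fintype ι]

theorem exists_polynomial_det (b : Basis ι ℝ E) (A : E →L[ℝ] E) : ∃ P : Polynomial ℝ,
    P.natDegree ≤ Fintype.card ι ∧ ∀ t : ℝ, P.eval t = (1 + t • A : E →L[ℝ] E).det := by
  classical
  set M := LinearMap.toMatrix b b A.toLinearMap with hM
  refine ⟨_, Polynomial.natDegree_det_X_add_C_le M 1, fun t => ?_⟩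
  have h1 : (1 + t • A : E →L[ℝ] E).toLinearMap = LinearMap.id + t • A.toLinearMap := rfl
  rw [ContinuousLinearMap.det, h1, ← LinearMap.det_toMatrix b, map_add, map_smul,
    LinearMap.toMatrix_id, ← hM, ← Polynomial.coe_evalRingHom, RingHom.map_det]
  congr 1
  ext i j
  simp only [RingHom.mapMatrix_apply, Matrix.map_apply, Matrix.add_apply, Matrix.smul_apply,
    smul_eq_mul, Polynomial.coe_evalRingHom, Polynomial.eval_add, Polynomial.eval_mul,
    Polynomial.eval_X, Polynomial.eval_C]
  rw [add_comm]

variable [FiniteDimensional ℝ E]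

/-- If `g` is continuously differentiable and periodic and `t` is small, then the Jacobian
determinant of `x ↦ x + t • g x` integrates to the volume of the unit cell. -/
theorem exists_integral_det_eq [MeasurableSpace E] [BorelSpace E] (μ : Measure E)
    [μ.IsAddHaarMeasure] (b : Basis ι ℝ E) {g : E → E} (hg : ContDiff ℝ 1 g)
    (hper : ∀ v ∈ Submodule.span ℤ (Set.range b), ∀ x, g (x + v) = g x) :
    ∃ δ > 0, ∀ t : ℝ, 0 < t → t < δ →
      ∫ x in ZSpan.fundamentalDomain b, (1 + t • fderiv ℝ g x : E →L[ℝ] E).det ∂μ =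
        μ.real (ZSpan.fundamentalDomain b) := by
  have : ProperSpace E := FiniteDimensional.proper ℝ E
  have hD : Continuous (fderiv ℝ g) := hg.continuous_fderiv one_ne_zero
  have hdiff : Differentiable ℝ g := hg.differentiable one_ne_zero
  have hDper : ∀ v ∈ Submodule.span ℤ (Set.range b), ∀ x, fderiv ℝ g (x + v) = fderiv ℝ g x := by
    intro v hv x
    rw [← fderiv_comp_add_right]
    congr 1
    exact funext fun y => hper v hv y
  obtain ⟨C, hC⟩ : ∃ C, ∀ x, ‖fderiv ℝ g x‖ ≤ C := by
    obtain ⟨C, hC⟩ := ((ZSpan.fundamentalDomain_isBounded b).isCompact_closure.image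
      hD).isBounded.exists_norm_le
    refine ⟨C, fun x => ?_⟩
    have hx := hDper _ (ZSpan.floor b x).2 (ZSpan.fract b x)
    rw [ZSpan.fract_apply, sub_add_cancel] at hx
    rw [hx]
    exact hC _ ⟨_, subset_closure (ZSpan.fract_mem_fundamentalDomain b x), rfl⟩
  have hC0 : 0 ≤ C := (norm_nonneg _).trans (hC 0)
  obtain ⟨ε, hε, hdet⟩ : ∃ ε > 0, ∀ A : E →L[ℝ] E, ‖A - 1‖ < ε → 0 < A.det := by
    have h1 : (1 : E →L[ℝ] E).det = 1 := LinearMap.det_id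
    have := (ContinuousLinearMap.continuous_det (𝕜 := ℝ) (E := E)).continuousAt.eventually
      (Ioi_mem_nhds (h1 ▸ one_pos : (0 : ℝ) < (1 : E →L[ℝ] E).det))
    obtain ⟨ε, hε, h⟩ := Metric.eventually_nhds_iff.1 this
    exact ⟨ε, hε, fun A hA => h (by rwa [dist_eq_norm])⟩
  -- The bound `t * C < 1` makes `x + t • g x` a homeomorphism, and `t * C < ε` makes its Jacobian
  -- positive; `C + 1` avoids division by zero.
  refine ⟨min 1 ε / (C + 1), by positivity, fun t ht htδ => ?_⟩
  rw [lt_div_iff₀ (by positivity)] at htδ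
  have htC : t * C < 1 := by nlinarith [min_le_left 1 ε]
  have htε : t * C < ε := by nlinarith [min_le_right 1 ε]
  let F : E → E := fun x => x + t • g x
  have hF' : ∀ x, HasFDerivAt F (1 + t • fderiv ℝ g x : E →L[ℝ] E) x := fun x =>
    (hasFDerivAt_id x).add ((hdiff x).hasFDerivAt.const_smul t)
  have hpos : ∀ x, 0 < (1 + t • fderiv ℝ g x : E →L[ℝ] E).det := fun x => hdet _ (by
    rw [add_sub_cancel_left, norm_smul, Real.norm_of_nonneg ht.le]
    exact (mul_le_mul_of_nonneg_left (hC x) ht.le).trans_lt htε)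
  have hLip : LipschitzWith ⟨C, hC0⟩ g :=
    lipschitzWith_of_nnnorm_fderiv_le hdiff fun x => NNReal.coe_le_coe.1 (hC x)
  have happ : ApproximatesLinearOn F (ContinuousLinearEquiv.refl ℝ E : E →L[ℝ] E) Set.univ
      ⟨t * C, by positivity⟩ := by
    intro x _ y _
    have h1 : F x - F y - (ContinuousLinearEquiv.refl ℝ E : E →L[ℝ] E) (x - y) =
        t • (g x - g y) := by
      simp only [F, ContinuousLinearEquiv.coe_refl, ContinuousLinearMap.id_apply, smul_sub]
      abel
    rw [h1, norm_smul, Real.norm_of_nonneg ht.le]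
    change _ ≤ t * C * _
    rw [mul_assoc]
    exact mul_le_mul_of_nonneg_left (hLip.norm_sub_le x y) ht.le
  have hc : Subsingleton E ∨ (⟨t * C, by positivity⟩ : NNReal) <
      ‖((ContinuousLinearEquiv.refl ℝ E).symm : E →L[ℝ] E)‖₊⁻¹ := by
    rcases subsingleton_or_nontrivial E with h | h
    · exact Or.inl h
    · refine Or.inr (NNReal.coe_lt_coe.1 ?_)
      change t * C < _
      simpa using htC
  let e := happ.toHomeomorph F hc
  have he : ∀ x, e x = F x := fun x => rfl
  have hFv : ∀ v ∈ Submodule.span ℤ (Set.range b), ∀ x, F (v + x) = v + F x := by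
    intro v hv x
    simp only [F]
    rw [add_comm v x, hper v hv]
    abel
  have hmeas := ZSpan.fundamentalDomain_measurableSet b
  have hQ := ZSpan.isAddFundamentalDomain b μ
  -- A homeomorphism commuting with the lattice carries a fundamental domain to a fundamental
  -- domain, and all of these have the same volume.
  have hFQ : IsAddFundamentalDomain (Submodule.span ℤ (Set.range b))
      (F '' ZSpan.fundamentalDomain b) μ := by
    refine IsAddFundamentalDomain.mk' ?_ fun x => ?_
    · exact (e.measurableEmbedding.measurableSet_image.2 hmeas).nullMeasurableSet
    · have key : ∀ v : Submodule.span ℤ (Set.range b),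
          v +ᵥ x ∈ F '' ZSpan.fundamentalDomain b ↔
            v +ᵥ e.symm x ∈ ZSpan.fundamentalDomain b := by
        intro v
        have h1 : v +ᵥ x = F (v +ᵥ e.symm x) := by
          have := hFv v v.2 (e.symm x)
          rw [← he (e.symm x), e.apply_symm_apply] at this
          exact this.symm
        rw [h1]
        exact e.injective.mem_set_image
      simp only [key]
      exact ZSpan.exist_unique_vadd_mem_fundamentalDomain b _
  have : VAddInvariantMeasure (Submodule.span ℤ (Set.range b)) E μ :=
    inferInstanceAs (VAddInvariantMeasure (Submodule.span ℤ (Set.range b)).toAddSubgroup E μ)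
  have hvol := hFQ.measure_eq hQ
  have hint := integral_image_eq_integral_abs_det_fderiv_smul μ hmeas
    (fun x _ => (hF' x).hasFDerivWithinAt) e.injective.injOn (fun _ => (1 : ℝ))
  simp only [abs_of_pos (hpos _), smul_eq_mul, mul_one] at hint
  rw [← hint, setIntegral_const, smul_eq_mul, mul_one, Measure.real, Measure.real, hvol]

/-- A continuously differentiable self-map of a Euclidean space which commutes with the
translations by a lattice has invertible derivative somewhere. -/
theorem exists_det_fderiv_ne_zero (b : Basis ι ℝ E) {h : E → E} (hh : ContDiff ℝ 1 h)
    (hper : ∀ v ∈ Submodule.span ℤ (Set.range b), ∀ x, h (x + v) = h x + v) :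
    ∃ x, (fderiv ℝ h x).det ≠ 0 := by
  by_contra! hdet
  have : ProperSpace E := FiniteDimensional.proper ℝ E
  borelize E
  let μ : Measure E := b.addHaar
  set g : E → E := fun x => h x - x with hgdef
  have hg : ContDiff ℝ 1 g := hh.sub contDiff_id
  obtain ⟨δ, hδ, hint⟩ := exists_integral_det_eq μ b hg (fun v hv x => by
    simp only [hgdef, hper v hv]
    abel)
  have hDg : ∀ x, (1 + (1 : ℝ) • fderiv ℝ g x : E →L[ℝ] E) = fderiv ℝ h x := by
    intro x
    have h1 : HasFDerivAt g (fderiv ℝ h x - 1) x :=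
      (hh.differentiable one_ne_zero x).hasFDerivAt.sub (hasFDerivAt_id x)
    rw [h1.fderiv, one_smul, add_sub_cancel]
  let n := Fintype.card ι
  -- Sample points strictly between `0` and `δ`, enough to determine a polynomial of degree at most
  -- `n`.
  let v : Fin (n + 1) → ℝ := fun j => δ * (j + 1) / (n + 2)
  have hv : Function.Injective v := by
    intro i j hij
    simp only [v] at hij
    have : (i : ℝ) = j := by field_simp at hij; linarith
    exact Fin.ext (by exact_mod_cast this)
  have hv0 : ∀ j, 0 < v j := fun j => by positivity
  have hvδ : ∀ j, v j < δ := fun j => by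
    have : (j : ℝ) < n + 1 := by exact_mod_cast j.2
    simp only [v]
    rw [div_lt_iff₀ (by positivity)]
    nlinarith
  obtain ⟨w, hw⟩ := exists_interpolation_weights hv 1
  have hw1 : ∑ j, w j = 1 := by simpa using (hw 1 (by simp)).symm
  have hdet' : ∀ A : E →L[ℝ] E, (1 + (1 : ℝ) • A : E →L[ℝ] E).det =
      ∑ j, w j * (1 + v j • A : E →L[ℝ] E).det := by
    intro A
    obtain ⟨P, hP, hPe⟩ := exists_polynomial_det b A
    simpa only [hPe] using hw P hP
  have hcont : ∀ t : ℝ, IntegrableOn (fun x => (1 + t • fderiv ℝ g x : E →L[ℝ] E).det)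
      (ZSpan.fundamentalDomain b) μ := by
    intro t
    have hc : Continuous fun x => (1 + t • fderiv ℝ g x : E →L[ℝ] E).det :=
      ContinuousLinearMap.continuous_det.comp
        (continuous_const.add ((hg.continuous_fderiv one_ne_zero).const_smul t))
    exact (hc.continuousOn.integrableOn_compact
      (ZSpan.fundamentalDomain_isBounded b).isCompact_closure).mono_set subset_closure
  -- Interpolation commutes with the integral, and its weights sum to one, so the constant value at
  -- the sample points persists at `t = 1`.
  have h0 : ∫ x in ZSpan.fundamentalDomain b, (1 + (1 : ℝ) • fderiv ℝ g x : E →L[ℝ] E).det ∂μ =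
      μ.real (ZSpan.fundamentalDomain b) := by
    simp only [hdet']
    rw [integral_finsetSum _ fun j _ => (hcont (v j)).const_mul (w j)]
    simp only [integral_const_mul, hint _ (hv0 _) (hvδ _)]
    rw [← Finset.sum_mul, hw1, one_mul]
  simp only [hDg, hdet, integral_zero] at h0
  refine ZSpan.measure_fundamentalDomain_ne_zero (μ := μ) b ?_
  exact ((measureReal_eq_zero_iff (ZSpan.fundamentalDomain_isBounded b).measure_lt_top.ne).1
    h0.symm)

end Degree

/-! ### Invariant covers of Euclidean space -/

section Covers

variable {r : ℕ}

/-- A smooth lattice-invariant measure of the distance of `y` from the orbit of `x`. -/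
def orbitDist (x y : Fin r → ℝ) : ℝ := ∑ l, (1 - Real.cos (2 * Real.pi * (y l - x l)))

theorem contDiff_orbitDist (x : Fin r → ℝ) {n : WithTop ℕ∞} : ContDiff ℝ n (orbitDist x) := by
  unfold orbitDist
  fun_prop

theorem orbitDist_self (x : Fin r → ℝ) : orbitDist x x = 0 := by simp [orbitDist]

theorem orbitDist_nonneg (x y : Fin r → ℝ) : 0 ≤ orbitDist x y :=
  Finset.sum_nonneg fun _ _ => sub_nonneg.2 (Real.cos_le_one _)

theorem orbitDist_latticeAct (x : Fin r → ℝ) (w : Multiplicative (Fin r → ℤ)) (y : Fin r → ℝ) :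
    orbitDist x (latticeAct r w y) = orbitDist x y := by
  refine Finset.sum_congr rfl fun l _ => ?_
  have : 2 * Real.pi * (y l + (w.toAdd l : ℤ) - x l) =
      2 * Real.pi * (y l - x l) + (w.toAdd l : ℤ) * (2 * Real.pi) := by ring
  rw [latticeAct_apply, this, Real.cos_add_int_mul_two_pi]

theorem exists_latticeAct_of_orbitDist_eq_zero {x y : Fin r → ℝ} (h : orbitDist x y = 0) :
    ∃ w, latticeAct r w x = y := by
  have h1 : ∀ l, ∃ k : ℤ, (k : ℝ) * (2 * Real.pi) = 2 * Real.pi * (y l - x l) := by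
    intro l
    refine (Real.cos_eq_one_iff _).1 ?_
    have := (Finset.sum_eq_zero_iff_of_nonneg
      (fun l _ => sub_nonneg.2 (Real.cos_le_one _))).1 h l (Finset.mem_univ l)
    linarith
  choose k hk using h1
  refine ⟨Multiplicative.ofAdd k, funext fun l => ?_⟩
  have : (k l : ℝ) = y l - x l :=
    mul_right_cancel₀ Real.two_pi_pos.ne' ((hk l).trans (mul_comm _ _))
  rw [latticeAct_apply, toAdd_ofAdd, this]
  ring

theorem exists_latticeAct_mem_Icc (y : Fin r → ℝ) :
    ∃ w, ∃ x ∈ Set.Icc (0 : Fin r → ℝ) 1, latticeAct r w x = y := by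
  refine ⟨Multiplicative.ofAdd fun l => ⌊y l⌋, fun l => Int.fract (y l),
    ⟨fun l => Int.fract_nonneg _, fun l => (Int.fract_lt_one _).le⟩, funext fun l => ?_⟩
  rw [latticeAct_apply]
  exact Int.fract_add_floor _

/-- A cover of `ℝ^r` by lattice-invariant open sets has a subordinate lattice-invariant smooth
partition of unity. -/
theorem exists_invariant_partition {κ : Type*} [Fintype κ] {V : κ → Set (Fin r → ℝ)}
    (hV : ∀ i, IsOpen (V i)) (hcov : ∀ x, ∃ i, x ∈ V i)
    (hinv : ∀ i w x, x ∈ V i → latticeAct r w x ∈ V i) :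
    ∃ ρ : κ → (Fin r → ℝ) → ℝ, (∀ i, ContDiff ℝ 1 (ρ i)) ∧ (∀ x, ∑ i, ρ i x = 1) ∧
      (∀ i w x, ρ i (latticeAct r w x) = ρ i x) ∧ ∀ i x, x ∉ V i → ∀ᶠ y in 𝓝 x, ρ i y = 0 := by
  classical
  have hsep : ∀ x, ∃ i, ∃ m > 0, ∀ y ∉ V i, m ≤ orbitDist x y := by
    intro x
    obtain ⟨i, hi⟩ := hcov x
    have hpos : ∀ y ∉ V i, 0 < orbitDist x y := fun y hy =>
      (orbitDist_nonneg x y).lt_of_ne' fun h => hy (by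
        obtain ⟨w, rfl⟩ := exists_latticeAct_of_orbitDist_eq_zero h
        exact hinv i w x hi)
    obtain ⟨m, hm, hm'⟩ := (isCompact_Icc.diff (hV i)).exists_forall_le'
      (contDiff_orbitDist (n := 1) x).continuous.continuousOn
      (fun y (hy : y ∈ Set.Icc (0 : Fin r → ℝ) 1 \ V i) => hpos y hy.2)
    refine ⟨i, m, hm, fun y hy => ?_⟩
    obtain ⟨w, y', hy', rfl⟩ := exists_latticeAct_mem_Icc y
    rw [orbitDist_latticeAct]
    exact hm' y' ⟨hy', fun h => hy (hinv i w y' h)⟩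
  choose i m hm hsep using hsep
  -- The cutoff is at half the distance `m x`, so that the bump vanishes on a neighbourhood of the
  -- complement of `V (i x)`.
  let b : (Fin r → ℝ) → (Fin r → ℝ) → ℝ := fun x y =>
    Real.smoothTransition (1 - 2 / m x * orbitDist x y)
  have hb : ∀ x, ContDiff ℝ 1 (b x) := fun x =>
    Real.smoothTransition.contDiff.comp
      (contDiff_const.sub (contDiff_const.mul (contDiff_orbitDist x)))
  have hb0 : ∀ x y, 0 ≤ b x y := fun x y => Real.smoothTransition.nonneg _
  have hbw : ∀ x w y, b x (latticeAct r w y) = b x y := fun x w y => by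
    simp only [b, orbitDist_latticeAct]
  have hbx : ∀ x, 0 < b x x := fun x => by simp [b, orbitDist_self]
  have hbV : ∀ x y, y ∉ V (i x) → ∀ᶠ y' in 𝓝 y, b x y' = 0 := by
    intro x y hy
    have h1 : m x / 2 < orbitDist x y := by linarith [hsep x y hy, hm x]
    filter_upwards [(contDiff_orbitDist (n := 1) x).continuous.continuousAt.eventually
      (Ioi_mem_nhds h1)] with y' hy'
    refine Real.smoothTransition.zero_of_nonpos ?_
    have h2 : 2 / m x * (m x / 2) = 1 := by field_simp [(hm x).ne']
    have h3 := mul_lt_mul_of_pos_left (Set.mem_Ioi.1 hy') (div_pos two_pos (hm x))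
    linarith
  obtain ⟨T, -, hT⟩ := isCompact_Icc.elim_nhds_subcover (s := Set.Icc (0 : Fin r → ℝ) 1)
    (fun x => {y | 0 < b x y})
    (fun x _ => (isOpen_lt continuous_const (hb x).continuous).mem_nhds (hbx x))
  let B : (Fin r → ℝ) → ℝ := fun y => ∑ x ∈ T, b x y
  have hBw : ∀ w y, B (latticeAct r w y) = B y := fun w y => by simp only [B, hbw]
  have hBpos : ∀ y, 0 < B y := by
    intro y
    obtain ⟨w, y', hy', rfl⟩ := exists_latticeAct_mem_Icc y
    rw [hBw]
    obtain ⟨x, hx, hxy⟩ := Set.mem_iUnion₂.1 (hT hy')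
    exact Finset.sum_pos' (fun x _ => hb0 x y') ⟨x, hx, hxy⟩
  have hB : ContDiff ℝ 1 B := ContDiff.sum fun x _ => hb x
  refine ⟨fun k y => (∑ x ∈ T with i x = k, b x y) / B y, fun k => ?_, fun y => ?_,
    fun k w y => ?_, fun k y hy => ?_⟩
  · exact (ContDiff.sum fun x _ => hb x).div hB fun y => (hBpos y).ne'
  · rw [← Finset.sum_div]
    exact (congrArg (· / B y) (Finset.sum_fiberwise T i fun x => b x y)).trans
      (div_self (hBpos y).ne')
  · simp only [hBw, hbw]
  · have : ∀ x ∈ T.filter (fun x => i x = k), ∀ᶠ y' in 𝓝 y, b x y' = 0 := fun x hx =>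
      hbV x y (by rw [(Finset.mem_filter.1 hx).2]; exact hy)
    filter_upwards [(Filter.eventually_all_finset _).2 this] with y' hy'
    rw [Finset.sum_eq_zero hy', zero_div]

/-- If `ℝ^r` is covered by `k + 1` open lattice-invariant sets on which there are equivariant
locally constant maps to `ℝ^r`, then `r ≤ k`. -/
theorem le_of_locally_constant_cover {k : ℕ} {V : Fin (k + 1) → Set (Fin r → ℝ)}
    (hV : ∀ i, IsOpen (V i)) (hcov : ∀ x, ∃ i, x ∈ V i)
    (hinv : ∀ i w x, x ∈ V i → latticeAct r w x ∈ V i)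
    {ζ : Fin (k + 1) → (Fin r → ℝ) → Fin r → ℝ}
    (hζ : ∀ i, ∀ x ∈ V i, ∀ᶠ y in 𝓝 x, ζ i y = ζ i x)
    (hζw : ∀ i w, ∀ x ∈ V i, ζ i (latticeAct r w x) = latticeAct r w (ζ i x)) : r ≤ k := by
  obtain ⟨ρ, hρ, hsum, hρw, hρV⟩ := exists_invariant_partition hV hcov hinv
  let h : (Fin r → ℝ) → Fin r → ℝ := fun x => ∑ i, ρ i x • ζ i x
  -- Near `x` each `ζ i` is either constant or multiplied by zero, so it can be frozen when
  -- differentiating.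
  have hloc : ∀ x, h =ᶠ[𝓝 x] fun y => ∑ i, ρ i y • ζ i x := by
    intro x
    have : ∀ i, ∀ᶠ y in 𝓝 x, ρ i y • ζ i y = ρ i y • ζ i x := by
      intro i
      by_cases hx : x ∈ V i
      · exact (hζ i x hx).mono fun y hy => by rw [hy]
      · exact (hρV i x hx).mono fun y hy => by rw [hy, zero_smul, zero_smul]
    filter_upwards [Filter.eventually_all.2 this] with y hy
    exact Finset.sum_congr rfl fun i _ => hy i
  have hsmooth : ContDiff ℝ 1 h := contDiff_iff_contDiffAt.2 fun x =>
    ContDiffAt.congr_of_eventuallyEq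
      (ContDiff.sum fun i _ => (hρ i).smul contDiff_const).contDiffAt (hloc x)
  have hdiff : ∀ i, Differentiable ℝ (ρ i) := fun i => (hρ i).differentiable one_ne_zero
  have hlat : ∀ w x, h (latticeAct r w x) = latticeAct r w (h x) := by
    intro w x
    have h1 : ∀ i, ρ i (latticeAct r w x) • ζ i (latticeAct r w x) =
        ρ i x • ζ i x + ρ i x • (fun l => ((w.toAdd l : ℤ) : ℝ)) := by
      intro i
      rw [hρw]
      by_cases hx : x ∈ V i
      · rw [hζw i w x hx, ← smul_add]
        congr 1
        funext l
        rw [latticeAct_apply]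
        rfl
      · rw [(hρV i x hx).self_of_nhds]
        simp
    simp only [h, h1]
    rw [Finset.sum_add_distrib, ← Finset.sum_smul, hsum, one_smul]
    funext l
    rw [latticeAct_apply]
    rfl
  obtain ⟨x, hx⟩ := exists_det_fderiv_ne_zero (Pi.basisFun ℝ (Fin r)) hsmooth (by
    intro v hv x
    have hint := (Module.Basis.mem_span_iff_repr_mem ℤ (Pi.basisFun ℝ (Fin r)) v).1 hv
    choose w hw using hint
    have hvw : ∀ y, y + v = latticeAct r (Multiplicative.ofAdd w) y := by
      intro y
      funext l
      rw [latticeAct_apply, toAdd_ofAdd]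
      have := hw l
      simp only [Pi.basisFun_repr, algebraMap_int_eq, Int.coe_castRingHom] at this
      rw [Pi.add_apply, this]
    rw [hvw, hvw, hlat])
  -- Since the differentials of the `ρ i` sum to zero, the index `0` can be eliminated, leaving only
  -- `k` directions.
  have hD : ∀ v, fderiv ℝ h x v = ∑ i : Fin k, fderiv ℝ (ρ i.succ) x v •
      (ζ i.succ x - ζ 0 x) := by
    intro v
    have h1 : HasFDerivAt h (∑ i, (fderiv ℝ (ρ i) x).smulRight (ζ i x)) x :=
      (HasFDerivAt.fun_sum fun i _ =>
        ((hdiff i x).hasFDerivAt.smul_const (ζ i x))).congr_of_eventuallyEq (hloc x)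
    have h2 : HasFDerivAt (fun y => ∑ i, ρ i y) (∑ i, fderiv ℝ (ρ i) x) x :=
      HasFDerivAt.fun_sum fun i _ => (hdiff i x).hasFDerivAt
    have h3 : (∑ i, fderiv ℝ (ρ i) x) = 0 := by
      refine h2.unique ?_
      simp only [hsum]
      exact hasFDerivAt_const _ _
    have h4 : fderiv ℝ (ρ 0) x v = -∑ i : Fin k, fderiv ℝ (ρ i.succ) x v := by
      have := congrArg (fun L : (Fin r → ℝ) →L[ℝ] ℝ => L v) h3
      simp only [sum_apply, zero_apply] at this
      rw [Fin.sum_univ_succ] at this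
      linarith
    rw [h1.fderiv]
    simp only [sum_apply, ContinuousLinearMap.smulRight_apply]
    rw [Fin.sum_univ_succ, h4]
    simp only [smul_sub, Finset.sum_sub_distrib, neg_smul, Finset.sum_smul]
    abel
  have hsurj : LinearMap.range (fderiv ℝ h x).toLinearMap = ⊤ := by
    refine LinearMap.range_eq_top.2 ?_
    have : IsUnit (LinearMap.det (fderiv ℝ h x).toLinearMap) := isUnit_iff_ne_zero.2 hx
    exact (LinearEquiv.ofIsUnitDet (v := Pi.basisFun ℝ (Fin r)) (v' := Pi.basisFun ℝ (Fin r))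
      (f := (fderiv ℝ h x).toLinearMap) (by rwa [LinearMap.det_toMatrix])).surjective
  have hle : (⊤ : Submodule ℝ (Fin r → ℝ)) ≤
      Submodule.span ℝ (Set.range fun i : Fin k => ζ i.succ x - ζ 0 x) := by
    rw [← hsurj]
    rintro _ ⟨v, rfl⟩
    change fderiv ℝ h x v ∈ _
    rw [hD]
    exact Submodule.sum_mem _ fun i _ => Submodule.smul_mem _ _ (Submodule.subset_span ⟨i, rfl⟩)
  calc r = Module.finrank ℝ (⊤ : Submodule ℝ (Fin r → ℝ)) := by simp
    _ ≤ _ := Submodule.finrank_mono hle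
    _ ≤ Fintype.card (Fin k) := finrank_range_le_card _
    _ = k := Fintype.card_fin k

end Covers

/-! ### The lower bound for the category -/

section LowerBound

theorem exists_latticeNumeration (r : ℕ) : Nonempty (Numeration (latticeAct r) (Fin (r + 1))) := by
  obtain ⟨ρ, hρ, hsum, hρw, hρV⟩ := exists_invariant_partition (V := offGrid (r := r))
    isOpen_offGrid exists_mem_offGrid fun i w _ hx => latticeAct_mem_offGrid i w hx
  let t : Fin (r + 1) → C(Fin r → ℝ, I) := fun i =>
    ⟨fun x => Set.projIcc 0 1 zero_le_one ((r + 1) * ρ i x), by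
      have := (hρ i).continuous
      fun_prop⟩
  have ht : ∀ i x, t i x = Set.projIcc 0 1 zero_le_one ((r + 1) * ρ i x) := fun _ _ => rfl
  have hsupp : ∀ i, ∀ x ∈ closure {x | t i x ≠ 0}, x ∈ offGrid i := by
    intro i x hx
    by_contra hV
    obtain ⟨y, hy, hy0⟩ := mem_closure_iff_nhds.1 hx _ (hρV i x hV)
    refine hy0 ?_
    rw [ht, show ρ i y = 0 from hy, mul_zero]
    exact Set.projIcc_left _
  refine ⟨⟨t, cell, locallyFinite_of_finite _, fun x => ?_, fun i w x => ?_,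
    fun i x hx => eventually_cell_eq (hsupp i x hx), fun i w x _ => cell_latticeAct i w x⟩⟩
  -- Some `ρ i x` is at least the average `1 / (r + 1)`; scaling by `r + 1` and truncating then
  -- gives exactly one.
  · obtain ⟨i, -, hi⟩ := Finset.exists_le_of_sum_le (s := Finset.univ) Finset.univ_nonempty
      (f := fun _ : Fin (r + 1) => (1 : ℝ) / (r + 1)) (g := fun i => ρ i x) (by
        rw [hsum, Finset.sum_const, Finset.card_univ, Fintype.card_fin, nsmul_eq_mul]
        push_cast
        exact (mul_one_div_cancel (by positivity)).le)
    refine ⟨i, Set.projIcc_of_right_le zero_le_one ?_⟩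
    rw [div_le_iff₀ (by positivity)] at hi
    linarith
  · rw [ht, ht, hρw]

/-- Run from its constant end, the homotopy lifts starting at a constant map, and the far end of the
lift is a lift of `φ` over `U`. -/
theorem exists_lift_of_nullhomotopic {F : Type*} [TopologicalSpace F] {X Y : Type*}
    [TopologicalSpace X] [TopologicalSpace Y] {q : F → Y} (hq : IsCoveringMap q)
    (hsurj : Function.Surjective q) {φ : C(X, Y)} {U : Set X}
    (h : (φ.restrict U).Nullhomotopic) :
    ∃ s : X → F, ContinuousOn s U ∧ ∀ x ∈ U, q (s x) = φ x := by
  classical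
  obtain ⟨y, ⟨h⟩⟩ := h
  obtain ⟨f₀, rfl⟩ := hsurj y
  let K := h.symm
  let L := hq.liftHomotopy K.toContinuousMap (ContinuousMap.const U f₀) fun x => K.apply_zero x
  have hL : ∀ x : U, q (L (1, x)) = φ x := fun x =>
    (congrFun (hq.liftHomotopy_lifts K.toContinuousMap _ _) (1, x)).trans (K.apply_one x)
  refine ⟨fun x => if hx : x ∈ U then L (1, ⟨x, hx⟩) else f₀, ?_, fun x hx => ?_⟩
  · rw [continuousOn_iff_continuous_domRestrict]
    refine (by fun_prop : Continuous fun x : U => L (1, x)).congr fun x => ?_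
    simp
  · simp only [dif_pos hx, hL]

variable {G H : Type} [Group G] [Group H] {X : Type u} {Y : Type v} [TopologicalSpace X]
  [TopologicalSpace Y] {E : Type u} [TopologicalSpace E] {F : Type v} [TopologicalSpace F]

theorem le_of_catLE {p : E → X} {ρ : G →* (E ≃ₜ E)} {q : F → Y} {τ : H →* (F ≃ₜ F)}
    {φ : C(X, Y)} {ψ : C(E, F)} {f : G →* H} [ContractibleSpace E] (hE : IsDeck p ρ)
    (hF : IsDeck q τ) (hψ : ∀ e, q (ψ e) = φ (p e)) (hψf : ∀ g e, ψ (ρ g e) = τ (f g) (ψ e))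
    {r : ℕ} (j : Multiplicative (Fin r → ℤ) →* G) (π : H →* Multiplicative (Fin r → ℤ))
    {a : Fin r → ℤ} (ha : ∀ l, a l ≠ 0)
    (hπ : ∀ w l, (π (f (j w))).toAdd l = a l * w.toAdd l) {k : ℕ} (hk : CatLE φ k) : r ≤ k := by
  obtain ⟨N⟩ := exists_latticeNumeration r
  obtain ⟨b, hb⟩ := N.exists_equivariant ρ j
  obtain ⟨U, hU, hcov, hnull⟩ := hk
  choose s hs hqs using fun i =>
    exists_lift_of_nullhomotopic hF.isCoveringMap hF.surjective (hnull i)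
  have hp := hE.isCoveringMap.continuous
  have hpb : Continuous fun x => p (b x) := hp.comp b.continuous
  have hpw : ∀ w x, p (b (latticeAct r w x)) = p (b x) := fun w x => by rw [hb, hE.map_act]
  -- The deck transformation between `ψ ∘ b` and the local lift is equivariant only up to the
  -- diagonal factors `a l`; dividing by them is why `ζ` takes real values.
  refine le_of_locally_constant_cover (V := fun i => {x | p (b x) ∈ U i})
    (ζ := fun i x l => ((π (hF.diff (ψ (b x)) (s i (p (b x))))).toAdd l : ℝ) / a l)
    (fun i => (hU i).preimage hpb) (fun x => ?_) (fun i w x hx => ?_) (fun i x hx => ?_)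
    fun i w x hx => funext fun l => ?_
  · obtain ⟨i, hi⟩ := Set.mem_iUnion.1 (hcov.ge (Set.mem_univ (p (b x))))
    exact ⟨i, hi⟩
  · exact (congrArg (· ∈ U i) (hpw w x)).mpr hx
  · have hpx : U i ∈ 𝓝 (p (b x)) := (hU i).mem_nhds hx
    have := hF.eventually_diff_eq (A := fun x => ψ (b x)) (B := fun x => s i (p (b x)))
      (t₀ := x) (by fun_prop)
      (ContinuousAt.comp (f := fun x => p (b x)) ((hs i).continuousAt hpx) hpb.continuousAt) (by
        filter_upwards [hpb.continuousAt.eventually hpx] with y hy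
        rw [hψ, hqs i _ hy])
    exact this.mono fun y hy => by simp only [hy]
  · have hx' : q (ψ (b x)) = q (s i (p (b x))) := by rw [hψ, hqs i _ hx]
    have ha' : (a l : ℝ) ≠ 0 := by exact_mod_cast ha l
    rw [latticeAct_apply]
    simp only [hpw]
    rw [hb, hψf, hF.diff_act hx', map_mul, toAdd_mul, Pi.add_apply, hπ]
    push_cast
    field_simp
    ring

end LowerBound

/-! ### Cocycles representing the trivial class -/

section Cocycles

variable {k G : Type u} [CommRing k] [Group G] {A : Rep.{u} k G}

theorem exists_d_eq_of_π_eq_zero {n : ℕ} {c : (Fin (n + 1) → G) → A}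
    {hc : inhomogeneousCochains.d A (n + 1) c = 0}
    (h : groupCohomology.π A (n + 1) (groupCohomology.cocyclesMk c hc) = 0) :
    ∃ w : (Fin n → G) → A, inhomogeneousCochains.d A n w = c := by
  let K := groupCohomology.inhomogeneousCochains A
  have hex : (ShortComplex.mk (K.toCycles n (n + 1)) (K.homologyπ (n + 1))
      (K.toCycles_comp_homologyπ n (n + 1))).Exact :=
    ShortComplex.exact_of_g_is_cokernel _ (K.homologyIsCokernel n (n + 1) (by simp))
  obtain ⟨w, hw⟩ := (ShortComplex.moduleCat_exact_iff _).1 hex _ h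
  refine ⟨w, ?_⟩
  have h1 := congrArg (groupCohomology.iCocycles A (n + 1)) hw
  rw [groupCohomology.iCocycles_mk] at h1
  rw [← h1, ← groupCohomology.inhomogeneousCochains.d_def]
  exact (ConcreteCategory.congr_hom (K.toCycles_i n (n + 1)) w).symm

theorem eq_zero_of_π_eq_zero {c : (Fin 0 → G) → A} {hc : inhomogeneousCochains.d A 0 c = 0}
    (h : groupCohomology.π A 0 (groupCohomology.cocyclesMk c hc) = 0) : c = 0 := by
  have : IsIso (groupCohomology.π A 0) :=
    CochainComplex.isIso_homologyπ₀ (groupCohomology.inhomogeneousCochains A)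
  have h1 : groupCohomology.cocyclesMk c hc = 0 :=
    (ModuleCat.mono_iff_injective (groupCohomology.π A 0)).1 inferInstance
      (h.trans (map_zero _).symm)
  rw [← groupCohomology.iCocycles_mk c hc, h1, map_zero]

end Cocycles

/-! ### Evaluation of cocycles on the fundamental class of a lattice -/

section Antisymmetrize

open Equiv

/-- Reindexing by the transposition flips every sign, so the sum equals its own negative. -/
theorem sum_sign_mul_eq_zero_of_swap {n : ℕ} (F : Perm (Fin n) → ℤ) {i j : Fin n} (hij : i ≠ j)
    (h : ∀ s, F (s * swap i j) = F s) : ∑ s, (Perm.sign s : ℤ) * F s = 0 := by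
  have h1 : ∑ s, (Perm.sign s : ℤ) * F s = ∑ s, -((Perm.sign s : ℤ) * F s) := by
    rw [← Equiv.sum_comp (Equiv.mulRight (swap i j))]
    refine Finset.sum_congr rfl fun s _ => ?_
    rw [Equiv.coe_mulRight, h, Perm.sign_mul, Perm.sign_swap hij]
    simp
  rw [Finset.sum_neg_distrib] at h1
  linarith

/-- The antisymmetrisation of a coboundary with trivial coefficients on a commutative group
vanishes. -/
theorem sum_sign_mul_coboundary {G : Type*} [Group G] (hG : ∀ a b : G, a * b = b * a) {n : ℕ}
    (w : (Fin n → G) → ℤ) (x : Fin (n + 1) → G) :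
    ∑ s : Perm (Fin (n + 1)), (Perm.sign s : ℤ) * (w (fun i => x (s i.succ)) +
      ∑ j : Fin (n + 1), (-1) ^ ((j : ℕ) + 1) *
        w (Fin.contractNth j (· * ·) (fun i => x (s i)))) = 0 := by
  have hlast : ∀ s : Perm (Fin (n + 1)),
      Fin.contractNth (Fin.last n) (· * ·) (fun i => x (s i)) = fun i => x (s i.castSucc) := by
    intro s
    ext i
    rw [Fin.contractNth_apply_of_lt _ _ _ _ (by simp)]
  -- An inner face multiplies two adjacent arguments, so in a commutative group it is unchanged when
  -- they are swapped.
  have hmid : ∀ j : Fin n, ∑ s : Perm (Fin (n + 1)), (Perm.sign s : ℤ) *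
      w (Fin.contractNth j.castSucc (· * ·) (fun i => x (s i))) = 0 := by
    intro j
    refine sum_sign_mul_eq_zero_of_swap _ (i := j.castSucc) (j := j.succ)
      (Fin.castSucc_lt_succ).ne fun s => congrArg w (funext fun i => ?_)
    rcases lt_trichotomy (i : ℕ) j with h | h | h
    · rw [Fin.contractNth_apply_of_lt _ _ _ _ (by simpa using h),
        Fin.contractNth_apply_of_lt _ _ _ _ (by simpa using h), Perm.mul_apply,
        swap_apply_of_ne_of_ne]
      · exact fun e => by simp [Fin.ext_iff] at e; omega
      · exact fun e => by simp [Fin.ext_iff] at e; omega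
    · obtain rfl := Fin.ext h
      rw [Fin.contractNth_apply_of_eq _ _ _ _ (by simp),
        Fin.contractNth_apply_of_eq _ _ _ _ (by simp), Perm.mul_apply, Perm.mul_apply,
        swap_apply_left, swap_apply_right, hG]
    · rw [Fin.contractNth_apply_of_gt _ _ _ _ (by simpa using h),
        Fin.contractNth_apply_of_gt _ _ _ _ (by simpa using h), Perm.mul_apply,
        swap_apply_of_ne_of_ne]
      · exact fun e => by simp [Fin.ext_iff] at e; omega
      · exact fun e => by simp [Fin.ext_iff] at e; omega
  -- The cyclic shift, of sign `(-1) ^ n`, exchanges the two outer faces; against the coboundary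
  -- sign `(-1) ^ (n + 1)` they cancel.
  have hrot : ∑ s : Perm (Fin (n + 1)), (Perm.sign s : ℤ) * w (fun i => x (s i.castSucc)) =
      (-1) ^ n * ∑ s : Perm (Fin (n + 1)), (Perm.sign s : ℤ) * w (fun i => x (s i.succ)) := by
    rw [← Equiv.sum_comp (Equiv.mulRight (finRotate (n + 1))), Finset.mul_sum]
    refine Finset.sum_congr rfl fun s _ => ?_
    have h1 : ∀ i : Fin n, (s * finRotate (n + 1)) i.castSucc = s i.succ := fun i => by
      rw [Perm.mul_apply, finRotate_apply, Fin.coeSucc_eq_succ]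
    simp only [Equiv.coe_mulRight, h1, Perm.sign_mul, sign_finRotate]
    push_cast
    ring
  simp only [Fin.sum_univ_castSucc, mul_add, Finset.mul_sum, Finset.sum_add_distrib, hlast]
  rw [Finset.sum_comm]
  simp only [mul_left_comm ((Perm.sign _ : ℤˣ) : ℤ), ← Finset.mul_sum, hmid, hrot]
  simp only [mul_zero, Finset.sum_const_zero, zero_add, Fin.val_last, ← mul_assoc, ← pow_add]
  rw [show n + 1 + n = 2 * n + 1 by ring, pow_succ, pow_mul]
  norm_num

end Antisymmetrize

/-! ### Non-vanishing of cup powers of the Berstein–Schwarz class -/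

section Nonvanishing

variable {G H : Type} [Group G] [Group H]

theorem d_comp_hom {A : Rep.{0} ℤ H} (f : G →* H) {n : ℕ} {c : (Fin n → H) → A}
    (hc : inhomogeneousCochains.d A n c = 0) :
    inhomogeneousCochains.d (Rep.res f A) n (fun g => c (f ∘ g)) = 0 := by
  funext g
  have := congrFun hc (f ∘ g)
  rw [inhomogeneousCochains.d_hom_apply] at this ⊢
  have h : ∀ j, f ∘ Fin.contractNth j (· * ·) g = Fin.contractNth j (· * ·) (f ∘ g) := fun j =>
    Fin.comp_contractNth _ _ (map_mul f) j g
  simp only [h]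
  exact this

theorem map_π_cocyclesMk {A : Rep.{0} ℤ H} (f : G →* H) {n : ℕ} {c : (Fin n → H) → A}
    (hc : inhomogeneousCochains.d A n c = 0) :
    groupCohomology.map f (𝟙 (Rep.res f A)) n
      (groupCohomology.π A n (groupCohomology.cocyclesMk c hc)) =
      groupCohomology.π (Rep.res f A) n
        (groupCohomology.cocyclesMk (fun g => c (f ∘ g)) (d_comp_hom f hc)) := by
  rw [groupCohomology.π_map_apply]
  congr 1
  refine (ModuleCat.mono_iff_injective (groupCohomology.iCocycles (Rep.res f A) n)).1
    inferInstance ?_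
  rw [groupCohomology.iCocycles_mk]
  refine (ConcreteCategory.congr_hom (HomologicalComplex.cyclesMap_i
    (groupCohomology.cochainsMap f (𝟙 (Rep.res f A))) n) _).trans ?_
  refine (congrArg ((groupCohomology.cochainsMap f (𝟙 (Rep.res f A))).f n)
    (groupCohomology.iCocycles_mk c hc)).trans ?_
  rfl

/-- The `ℤ`-linear extension to `ℤ[H]` of a homomorphism from `H` to `ℤ`. -/
def linearExtension (l : H →* Multiplicative ℤ) : ℤ[H] →ₗ[ℤ] ℤ :=
  Finsupp.lift ℤ ℤ H (fun h => (l h).toAdd) ∘ₗ (MonoidAlgebra.coeffLinearEquiv ℤ).toLinearMap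

theorem linearExtension_single (l : H →* Multiplicative ℤ) (h : H) (a : ℤ) :
    linearExtension l (MonoidAlgebra.single h a) = a * (l h).toAdd := by
  simp [linearExtension]

/-- The defect of invariance is a multiple of the augmentation, so the functional becomes invariant
on the augmentation ideal. -/
theorem linearExtension_ρ (l : H →* Multiplicative ℤ) (h : H) (x : ℤ[H]) :
    linearExtension l ((Rep.leftRegular ℤ H).ρ h x) =
      linearExtension l x + augmentation H x * (l h).toAdd := by
  induction x using MonoidAlgebra.induction_linear with
  | zero => simp
  | add x y hx hy =>
    rw [map_add, map_add, map_add, map_add, hx, hy]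
    ring
  | single g a =>
    have : (Rep.leftRegular ℤ H).ρ h (MonoidAlgebra.single g a) = MonoidAlgebra.single (h * g) a := by
      simp
    rw [this, linearExtension_single, linearExtension_single, augmentation_single, map_mul,
      toAdd_mul]
    ring

end Nonvanishing

/-! ### Invariant functionals on coefficient modules -/

section Functionals

variable {k G : Type} [CommRing k] [Group G]

/-- The `G`-invariant linear functionals on a representation. -/
def InvariantFunctional (A : Rep.{0} k G) : Type :=
  {a : A →ₗ[k] k // ∀ g x, a (A.ρ g x) = a x}

/-- The product of two invariant functionals on the tensor product. -/
def InvariantFunctional.tensor {A B : Rep.{0} k G} (a : InvariantFunctional A)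
    (b : InvariantFunctional B) : InvariantFunctional (A ⊗ B : Rep.{0} k G) :=
  ⟨LinearMap.mul' k k ∘ₗ TensorProduct.map a.1 b.1, fun g x => by
    suffices h : (LinearMap.mul' k k ∘ₗ TensorProduct.map a.1 b.1) ∘ₗ
        TensorProduct.map (A.ρ g) (B.ρ g) = LinearMap.mul' k k ∘ₗ TensorProduct.map a.1 b.1 from
      LinearMap.congr_fun h x
    ext x y
    simp [a.2, b.2]⟩

/-- Invariance of `b` absorbs the translation by the partial product in `cup`. -/
theorem InvariantFunctional.tensor_cup {A B : Rep.{0} k G} (a : InvariantFunctional A)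
    (b : InvariantFunctional B) {p q : ℕ} (c : (Fin p → G) → A) (d : (Fin q → G) → B)
    (g : Fin (p + q) → G) : (a.tensor b).1 (cup c d g) =
      a.1 (c fun i => g (Fin.castAdd q i)) * b.1 (d fun i => g (Fin.natAdd p i)) :=
  congrArg (_ * ·) (b.2 _ _)

/-- An invariant functional takes a coboundary to a coboundary with trivial coefficients. -/
theorem InvariantFunctional.d_apply {A : Rep.{0} k G} (a : InvariantFunctional A) {n : ℕ}
    (w : (Fin n → G) → A) (g : Fin (n + 1) → G) :
    a.1 (inhomogeneousCochains.d A n w g) = a.1 (w fun i => g i.succ) +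
      ∑ j : Fin (n + 1), (-1) ^ ((j : ℕ) + 1) * a.1 (w (Fin.contractNth j (· * ·) g)) := by
  rw [inhomogeneousCochains.d_hom_apply, map_add, a.2, map_sum]
  simp only [map_smul, smul_eq_mul]

/-- Restriction of an invariant functional along a homomorphism. -/
def InvariantFunctional.res {H : Type} [Group H] {A : Rep.{0} k G} (a : InvariantFunctional A)
    (f : H →* G) : InvariantFunctional (Rep.res f A) :=
  ⟨a.1, fun g x => a.2 (f g) x⟩

end Functionals

section Nonvanishing

variable {G H : Type} [Group G] [Group H]

/-- The invariant functional `I(H) → ℤ` which takes `g - 1` to `l g`. -/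
def augIdealFunctional (l : H →* Multiplicative ℤ) : InvariantFunctional (augIdeal H) :=
  ⟨linearExtension l ∘ₗ Submodule.subtype (LinearMap.ker (augmentation H)), fun h y => by
    refine (linearExtension_ρ l h y.1).trans ?_
    rw [show augmentation H y.1 = 0 from y.2, zero_mul, add_zero]
    rfl⟩

theorem augIdealFunctional_bersteinCochain (l : H →* Multiplicative ℤ) (g : Fin 1 → H) :
    (augIdealFunctional l).1 (bersteinCochain H g) = (l (g 0)).toAdd := by
  change linearExtension l (MonoidAlgebra.single _ 1 - MonoidAlgebra.single 1 1) = _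
  rw [map_sub, linearExtension_single, linearExtension_single]
  simp

/-- The invariant functional `I(H)^{⊗ k} → ℤ` which takes the product of the `g i - 1` to the
product of the `l i (g i)`. -/
def augPowFunctional (l : ℕ → H →* Multiplicative ℤ) : (k : ℕ) →
    InvariantFunctional (augPow H k)
  | 0 => ⟨(LinearMap.id : ℤ →ₗ[ℤ] ℤ), fun _ _ => rfl⟩
  | k + 1 => (augPowFunctional l k).tensor (augIdealFunctional (l k))

theorem augPowFunctional_bersteinPowCochain (l : ℕ → H →* Multiplicative ℤ) (k : ℕ)
    (g : Fin k → H) :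
    (augPowFunctional l k).1 (bersteinPowCochain H k g) = ∏ i : Fin k, (l i (g i)).toAdd := by
  induction k with
  | zero => rfl
  | succ k ih =>
    rw [Fin.prod_univ_castSucc]
    refine (InvariantFunctional.tensor_cup _ _ _ _ _).trans ?_
    rw [augIdealFunctional_bersteinCochain, ih]
    rfl

theorem pullbackBersteinPow_eq (f : G →* H) (k : ℕ) : pullbackBersteinPow f k =
    groupCohomology.π (Rep.res f (augPow H k)) k (groupCohomology.cocyclesMk
      (fun g => bersteinPowCochain H k (f ∘ g)) (d_comp_hom f (d_bersteinPowCochain H k))) :=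
  map_π_cocyclesMk f (d_bersteinPowCochain H k)

/-- If some `k × k` determinant of integral homomorphisms evaluated on the image of `f` does not
vanish, then neither does the pullback along `f` of the `k`-th power of the Berstein–Schwarz
class. -/
theorem pullbackBersteinPow_ne_zero (hG : ∀ a b : G, a * b = b * a) (f : G →* H) {k : ℕ}
    (l : ℕ → H →* Multiplicative ℤ) (x : Fin k → G)
    (hdet : (Matrix.of fun i j : Fin k => (l j (f (x i))).toAdd).det ≠ 0) :
    pullbackBersteinPow f k ≠ 0 := by
  rw [pullbackBersteinPow_eq]
  intro h
  cases k with
  | zero =>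
    -- There are no coboundaries in degree zero, and the cocycle is the constant `1`.
    have := congrFun (eq_zero_of_π_eq_zero h) x
    exact one_ne_zero (α := ℤ) this
  | succ k =>
    obtain ⟨w, hw⟩ := exists_d_eq_of_π_eq_zero h
    refine hdet ?_
    rw [Matrix.det_apply', ← sum_sign_mul_coboundary hG
      (fun g => ((augPowFunctional l (k + 1)).res f).1 (w g)) x]
    refine Finset.sum_congr rfl fun s _ => congrArg _ ?_
    refine Eq.trans ?_ (((augPowFunctional l (k + 1)).res f).d_apply w fun i => x (s i))
    exact ((congrArg (fun c => ((augPowFunctional l (k + 1)).res f).1 (c fun i => x (s i))) hw).trans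
      (augPowFunctional_bersteinPowCochain l (k + 1) _)).symm

end Nonvanishing

/-! ### The cohomological dimension of a lattice -/

section CohomologicalDimension

theorem exists_sub_eq {A : Type*} [AddCommGroup A] (v : ℤ → A) :
    ∃ u : ℤ → A, ∀ n, u (n + 1) - u n = v n := by
  refine ⟨fun n => Int.casesOn n (fun m => ∑ i ∈ Finset.range m, v i)
    (fun m => -∑ i ∈ Finset.range (m + 1), v (Int.negSucc i)), fun n => ?_⟩
  rcases n with n | n
  · change ∑ i ∈ Finset.range (n + 1), v i - ∑ i ∈ Finset.range n, v i = v n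
    rw [Finset.sum_range_succ, add_sub_cancel_left]
  · rcases n with _ | n
    · change ∑ i ∈ Finset.range 0, v i - -∑ i ∈ Finset.range 1, v (Int.negSucc i) = _
      simp
    · change -∑ i ∈ Finset.range (n + 1), v (Int.negSucc i) -
        -∑ i ∈ Finset.range (n + 2), v (Int.negSucc i) = _
      rw [Finset.sum_range_succ _ (n + 1)]
      abel

variable {k G : Type u} [CommRing k] [Group G]

/-- The endomorphism `φ ↦ (h ↦ t⁻¹ φ (t h) - φ h)` of the representation coinduced from the
restriction of `M` to a subgroup. -/
def coindSub (hG : ∀ a b : G, a * b = b * a) (M : Rep.{u} k G) (S : Subgroup G) (t : G) :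
    Rep.coind S.subtype (Rep.res S.subtype M) ⟶ Rep.coind S.subtype (Rep.res S.subtype M) :=
  Rep.ofHom
    { toFun := fun φ => ⟨fun h => M.ρ t⁻¹ (φ.1 (t * h)) - φ.1 h, fun s h => by
        have h1 := φ.2 s (t * h)
        have h2 := φ.2 s h
        rw [← mul_assoc, hG _ t, mul_assoc] at h1
        change M.ρ t⁻¹ (φ.1 (t * (S.subtype s * h))) - φ.1 (S.subtype s * h) = M.ρ s (_ - _)
        rw [h1, h2]
        change M.ρ t⁻¹ (M.ρ s _) - M.ρ s _ = M.ρ s _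
        rw [map_sub, ← Module.End.mul_apply, ← Module.End.mul_apply, ← map_mul, ← map_mul, hG s]⟩
      map_add' := fun φ ψ => Subtype.ext <| funext fun h => by
        change M.ρ t⁻¹ (φ.1 (t * h) + ψ.1 (t * h)) - (φ.1 h + ψ.1 h) = _ - _ + (_ - _)
        rw [map_add]
        abel
      map_smul' := fun c φ => Subtype.ext <| funext fun h => by
        change M.ρ t⁻¹ (c • φ.1 (t * h)) - c • φ.1 h = c • (_ - _)
        rw [map_smul, smul_sub]
      isIntertwining' := fun g => LinearMap.ext fun φ => Subtype.ext <| funext fun h => by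
        change M.ρ t⁻¹ (φ.1 (t * h * g)) - φ.1 (h * g) = M.ρ t⁻¹ (φ.1 (t * (h * g))) - φ.1 (h * g)
        rw [mul_assoc] }

/-- The short complex `M ⟶ Coind (Res M) ⟶ Coind (Res M)` attached to a subgroup and an
element. -/
def coindShortComplex (hG : ∀ a b : G, a * b = b * a) (M : Rep.{u} k G) (S : Subgroup G) (t : G) :
    ShortComplex (Rep k G) where
  f := Rep.resCoindToHom S.subtype M (Rep.res S.subtype M) (𝟙 _)
  g := coindSub hG M S t
  zero := by
    refine Rep.hom_ext (Representation.IntertwiningMap.ext <| LinearMap.ext fun m =>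
      Subtype.ext <| funext fun h => ?_)
    change M.ρ t⁻¹ (M.ρ (t * h) m) - M.ρ h m = 0
    rw [← Module.End.mul_apply, ← map_mul, inv_mul_cancel_left, sub_self]

theorem mul_inv_zpow_mem_ker (χ : G →* Multiplicative ℤ) {t : G}
    (ht : χ t = Multiplicative.ofAdd 1) (h : G) : h * (t ^ (χ h).toAdd)⁻¹ ∈ χ.ker := by
  rw [MonoidHom.mem_ker, map_mul, map_inv, map_zpow, ht, ← ofAdd_zsmul, smul_eq_mul, mul_one,
    ofAdd_toAdd, mul_inv_cancel]

theorem coindShortComplex_shortExact (hG : ∀ a b : G, a * b = b * a) (M : Rep.{u} k G)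
    (χ : G →* Multiplicative ℤ) {t : G} (ht : χ t = Multiplicative.ofAdd 1) :
    (coindShortComplex hG M χ.ker t).ShortExact where
  exact := by
    rw [← ShortComplex.exact_map_iff_of_faithful _ (forget₂ (Rep k G) (ModuleCat k))]
    refine (ShortComplex.moduleCat_exact_iff _).2 fun φ hφ => ⟨φ.1 1, ?_⟩
    have h1 : ∀ h, φ.1 (t * h) = M.ρ t (φ.1 h) := fun h => by
      have := congrFun (congrArg Subtype.val hφ) h
      change M.ρ t⁻¹ (φ.1 (t * h)) - φ.1 h = 0 at this
      rw [← sub_eq_zero.1 this, ← Module.End.mul_apply, ← map_mul, mul_inv_cancel, map_one,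
        Module.End.one_apply]
    -- Equivariance of `φ` holds on a subgroup containing both `χ.ker` and `t`, which together
    -- generate `G`.
    let K : Subgroup G :=
      { carrier := {g | ∀ h, φ.1 (g * h) = M.ρ g (φ.1 h)}
        mul_mem' := fun {a b} ha hb h => by
          rw [mul_assoc, ha, hb, map_mul, Module.End.mul_apply]
        one_mem' := fun h => by rw [one_mul, map_one, Module.End.one_apply]
        inv_mem' := fun {a} ha h => by
          rw [← mul_inv_cancel_left a h, ha, inv_mul_cancel_left, ← Module.End.mul_apply,
            ← map_mul, inv_mul_cancel, map_one, Module.End.one_apply] }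
    have hker : ∀ s ∈ χ.ker, s ∈ K := fun s hs h => φ.2 ⟨s, hs⟩ h
    refine Subtype.ext <| funext fun h => ?_
    have hK : h ∈ K := by
      have := K.mul_mem (hker _ (mul_inv_zpow_mem_ker χ ht h)) (K.zpow_mem h1 (χ h).toAdd)
      rwa [inv_mul_cancel_right] at this
    have := hK 1
    rw [mul_one] at this
    exact this.symm
  mono_f := (Rep.mono_iff_injective _).2 fun m m' h => by
    have h1 := congrFun (congrArg Subtype.val h) (1 : G)
    change M.ρ 1 m = M.ρ 1 m' at h1
    rwa [map_one] at h1
  epi_g := (Rep.epi_iff_surjective _).2 fun φ => by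
    -- After untwisting by the action, a preimage depends only on `χ h`, and finding it means
    -- solving a difference equation over `ℤ`.
    obtain ⟨u, hu⟩ := exists_sub_eq fun n : ℤ => M.ρ (t ^ n)⁻¹ (φ.1 (t ^ n))
    refine ⟨⟨fun h => M.ρ h (u (χ h).toAdd), fun s h => ?_⟩, Subtype.ext <| funext fun h => ?_⟩
    · have hs : χ s = 1 := s.2
      change M.ρ (s * h) (u (χ (s * h)).toAdd) = M.ρ s (M.ρ h _)
      rw [map_mul χ, hs, one_mul, map_mul, Module.End.mul_apply]
    · change M.ρ t⁻¹ (M.ρ (t * h) (u (χ (t * h)).toAdd)) - M.ρ h (u (χ h).toAdd) = φ.1 h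
      have h1 := φ.2 ⟨_, mul_inv_zpow_mem_ker χ ht h⟩ (t ^ (χ h).toAdd)
      change φ.1 (h * (t ^ (χ h).toAdd)⁻¹ * t ^ (χ h).toAdd) =
        M.ρ (h * (t ^ (χ h).toAdd)⁻¹) (φ.1 (t ^ (χ h).toAdd)) at h1
      rw [inv_mul_cancel_right] at h1
      rw [h1, ← Module.End.mul_apply, ← map_mul, inv_mul_cancel_left, map_mul χ, ht, toAdd_mul,
        toAdd_ofAdd, add_comm, ← map_sub, hu, ← Module.End.mul_apply, ← map_mul]

open Limits in
-- By Shapiro's lemma the coinduced module has the cohomology of the kernel, and the connecting map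
-- of `coindShortComplex` raises the vanishing range by one.
theorem isZero_groupCohomology_of_ker (hG : ∀ a b : G, a * b = b * a)
    (χ : G →* Multiplicative ℤ) {t : G} (ht : χ t = Multiplicative.ofAdd 1) {n : ℕ}
    (h : ∀ (M : Rep.{u} k χ.ker) (i : ℕ), n < i → IsZero (groupCohomology M i))
    (M : Rep.{u} k G) {i : ℕ} (hi : n + 1 < i) : IsZero (groupCohomology M i) := by
  obtain ⟨i, rfl⟩ : ∃ j, i = j + 1 := ⟨i - 1, by omega⟩
  have hX := coindShortComplex_shortExact hG M χ ht
  have h' : ∀ i, n < i → IsZero (groupCohomology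
      (Rep.coind χ.ker.subtype (Rep.res χ.ker.subtype M)) i) := fun i hi =>
    (h _ i hi).of_iso (groupCohomology.coindIso _ i)
  have h2 : IsZero (groupCohomology (coindShortComplex hG M χ.ker t).X₃ i) := h' _ (by omega)
  have := groupCohomology.epi_δ_of_isZero hX i (h' _ (by omega))
  have h3 : IsZero (groupCohomology (coindShortComplex hG M χ.ker t).X₁ (i + 1)) :=
    IsZero.of_epi (groupCohomology.δ hX i (i + 1) rfl) h2
  exact h3

theorem isZero_groupCohomology_lattice {r : ℕ} {G : Type u} [Group G]
    (e : G ≃* Multiplicative (Fin r → ℤ)) (M : Rep.{u} k G) {i : ℕ} (hi : r < i) :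
    Limits.IsZero (groupCohomology M i) := by
  have hG : ∀ {r : ℕ} {G : Type u} [Group G] (e : G ≃* Multiplicative (Fin r → ℤ)) (a b : G),
      a * b = b * a := fun e a b => e.injective (by rw [map_mul, map_mul, mul_comm])
  induction r generalizing G i with
  | zero =>
    have : Subsingleton G := e.toEquiv.subsingleton
    obtain ⟨j, rfl⟩ : ∃ j, i = j + 1 := ⟨i - 1, by omega⟩
    exact isZero_groupCohomology_succ_of_subsingleton M j
  | succ r ih =>
    let χ : G →* Multiplicative ℤ :=
      (AddMonoidHom.toMultiplicative (Pi.evalAddMonoidHom (fun _ : Fin (r + 1) => ℤ) 0)).comp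
        e.toMonoidHom
    let e' : χ.ker ≃* Multiplicative (Fin r → ℤ) :=
      { toFun := fun s => Multiplicative.ofAdd (Fin.tail (e s).toAdd)
        invFun := fun v => ⟨e.symm (Multiplicative.ofAdd (Fin.cons 0 v.toAdd)), by
          change Multiplicative.ofAdd ((e (e.symm _)).toAdd 0) = 1
          rw [MulEquiv.apply_symm_apply]
          rfl⟩
        left_inv := fun s => Subtype.ext <| e.injective <| by
          have h0 : (e s).toAdd 0 = 0 := s.2
          change e (e.symm _) = _
          rw [MulEquiv.apply_symm_apply]
          apply Multiplicative.toAdd.injective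
          have := Fin.cons_self_tail (e s).toAdd
          rw [h0] at this
          exact this
        right_inv := fun v => by
          change Multiplicative.ofAdd (Fin.tail (e (e.symm _)).toAdd) = v
          rw [MulEquiv.apply_symm_apply]
          rfl
        map_mul' := fun s s' => by
          change Multiplicative.ofAdd (Fin.tail (e (s * s' : G)).toAdd) = _
          rw [map_mul]
          rfl }
    refine isZero_groupCohomology_of_ker (hG e) χ
      (t := e.symm (Multiplicative.ofAdd (Pi.single 0 1))) ?_ (fun M i hi => ih e' M hi) M hi
    change Multiplicative.ofAdd ((e (e.symm _)).toAdd 0) = _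
    rw [MulEquiv.apply_symm_apply]
    simp

/-- The pullback of a power of the Berstein–Schwarz class along a homomorphism which factors
through a lattice of smaller rank vanishes. -/
theorem pullbackBersteinPow_eq_zero {G H : Type} [Group G] [Group H] {f : G →* H} {r : ℕ}
    (f' : G →* Multiplicative (Fin r → ℤ)) (j : Multiplicative (Fin r → ℤ) →* H)
    (hf : ∀ g, j (f' g) = f g) {i : ℕ} (hi : r < i) : pullbackBersteinPow f i = 0 := by
  obtain rfl : j.comp f' = f := MonoidHom.ext hf
  have h := pullbackBersteinPow_eq j i
  have hz : pullbackBersteinPow j i = 0 :=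
    have := ModuleCat.subsingleton_of_isZero
      (isZero_groupCohomology_lattice (MulEquiv.refl _) (Rep.res j (augPow H i)) hi)
    Subsingleton.elim _ _
  rw [h] at hz
  rw [pullbackBersteinPow_eq]
  -- The class is the pullback along `f'` of the class for `j`, which lives on `ℤ^r` and so is zero.
  have h2 := map_π_cocyclesMk f' (d_comp_hom j (d_bersteinPowCochain H i))
  rw [hz, map_zero] at h2
  exact h2.symm

end CohomologicalDimension

/-! ### Diagonalisation of homomorphisms of lattices -/

/-- Smith normal form provides a basis of the image made of nonzero multiples of members of a basis
of `ℤ^m`. Then `s` picks preimages of the image basis, `π` reads off the matching coordinates, and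
`f'` and `j` pass through coordinates on the image. -/
theorem exists_diagonalization {n m : ℕ} (f : (Fin n → ℤ) →+ (Fin m → ℤ)) :
    ∃ (r : ℕ) (f' : (Fin n → ℤ) →+ (Fin r → ℤ)) (j : (Fin r → ℤ) →+ (Fin m → ℤ))
      (s : (Fin r → ℤ) →+ (Fin n → ℤ)) (π : (Fin m → ℤ) →+ (Fin r → ℤ)) (a : Fin r → ℤ),
      r = Module.finrank ℤ f.range ∧ (∀ x, j (f' x) = f x) ∧ (∀ l, a l ≠ 0) ∧
        ∀ w l, π (f (s w)) l = a l * w l := by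
  let F : (Fin n → ℤ) →ₗ[ℤ] (Fin m → ℤ) := f.toIntLinearMap
  obtain ⟨r, b⟩ := Submodule.smithNormalForm (Pi.basisFun ℤ (Fin m)) (LinearMap.range F)
  have hrank : r = Module.finrank ℤ f.range := by
    have e : f.range ≃+ LinearMap.range F := AddEquiv.refl _
    rw [e.toIntLinearEquiv.finrank_eq, Module.finrank_eq_card_basis b.bN, Fintype.card_fin]
  choose y hy using fun i => (b.bN i).2
  refine ⟨r, (b.bN.equivFun.toLinearMap ∘ₗ F.rangeRestrict).toAddMonoidHom,
    ((LinearMap.range F).subtype ∘ₗ b.bN.equivFun.symm.toLinearMap).toAddMonoidHom,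
    (Fintype.linearCombination ℤ y).toAddMonoidHom,
    (LinearMap.pi fun l => b.bM.coord (b.f l)).toAddMonoidHom, b.a, hrank, fun x => ?_,
    fun l hl => ?_, fun w l => ?_⟩
  · change ((b.bN.equivFun.symm (b.bN.equivFun (F.rangeRestrict x)) : LinearMap.range F) :
      Fin m → ℤ) = F x
    rw [LinearEquiv.symm_apply_apply]
    rfl
  · have h := b.snf l
    rw [hl, zero_smul] at h
    exact b.bN.ne_zero l (Subtype.ext h)
  · change b.bM.coord (b.f l) (F (Fintype.linearCombination ℤ y w)) = _
    rw [Fintype.linearCombination_apply, map_sum, map_sum]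
    simp only [map_smul, hy, b.snf, Module.Basis.coord_apply, Module.Basis.repr_self,
      Finsupp.single_apply, smul_eq_mul, b.f.injective.eq_iff]
    simp [mul_comm]

theorem isGreatest_pullbackBersteinPow_ne_zero {G H : Type} [Group G] [Group H]
    (hG : ∀ a b : G, a * b = b * a) {f : G →* H} {r : ℕ}
    (f' : G →* Multiplicative (Fin r → ℤ)) (j : Multiplicative (Fin r → ℤ) →* H)
    (hf : ∀ g, j (f' g) = f g) (s : Multiplicative (Fin r → ℤ) →* G)
    (π : H →* Multiplicative (Fin r → ℤ)) {a : Fin r → ℤ} (ha : ∀ l, a l ≠ 0)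
    (hπ : ∀ w l, (π (f (s w))).toAdd l = a l * w.toAdd l) :
    IsGreatest {k : ℕ | pullbackBersteinPow f k ≠ 0} r := by
  refine ⟨?_, fun k hk => not_lt.1 fun h => hk (pullbackBersteinPow_eq_zero f' j hf h)⟩
  -- These are the coordinates of `π`; the trivial value for `i ≥ r` does not enter the `r × r`
  -- determinant.
  let l : ℕ → H →* Multiplicative ℤ := fun i =>
    if h : i < r then
      (AddMonoidHom.toMultiplicative (Pi.evalAddMonoidHom (fun _ : Fin r => ℤ) ⟨i, h⟩)).comp π
    else 1
  refine pullbackBersteinPow_ne_zero hG f l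
    (fun i => s (Multiplicative.ofAdd (Pi.single i (1 : ℤ)))) ?_
  have hl : ∀ (i : Fin r) (h : H), (l i h).toAdd = (π h).toAdd i := fun i h => by
    simp only [l, i.2, dif_pos]
    rfl
  have : (Matrix.of fun i i' : Fin r =>
      (l i' (f (s (Multiplicative.ofAdd (Pi.single i (1 : ℤ)))))).toAdd) = Matrix.diagonal a := by
    ext i i'
    rw [Matrix.of_apply, hl, hπ, toAdd_ofAdd, Matrix.diagonal_apply, Pi.single_apply]
    rcases eq_or_ne i i' with rfl | h
    · simp
    · simp [h, h.symm]
  rw [this, Matrix.det_diagonal]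
  exact Finset.prod_ne_zero_iff.2 fun i _ => ha i

/-- The chain `r ≤ cat φ ≤ TC φ ≤ r` settles both invariants at once. -/
theorem cat_TC_eq_of_lattice {G H : Type} [Group G] [Group H]
    (hG : ∀ a b : G, a * b = b * a) (hH : ∀ a b : H, a * b = b * a) {f : G →* H} {r : ℕ}
    (f' : G →* Multiplicative (Fin r → ℤ)) (j : Multiplicative (Fin r → ℤ) →* H)
    (hf : ∀ g, j (f' g) = f g) (s : Multiplicative (Fin r → ℤ) →* G)
    (π : H →* Multiplicative (Fin r → ℤ)) {a : Fin r → ℤ} (ha : ∀ l, a l ≠ 0)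
    (hπ : ∀ w l, (π (f (s w))).toAdd l = a l * w.toAdd l)
    {X : Type u} {Y : Type v} [TopologicalSpace X] [TopologicalSpace Y]
    {KX : EilenbergMacLane G X} {KY : EilenbergMacLane H Y} {φ : C(X, Y)}
    (hφ : Induces KX KY φ f) : cat φ = r ∧ TC φ = r := by
  have := KX.t2
  have := KX.paracompact
  have : Nonempty X := ⟨KX.base⟩
  obtain ⟨E, _, p, ρ, F, _, q, τ, ψ, hE, _, hF, _, hψ, hψf⟩ :=
    hφ.exists_equivariant_lift hG hH
  have h1 : TC φ ≤ r := iInf₂_le r (TCLE_of_equivariant hE hF hψ hψf hH f' j hf)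
  have h2 : (r : ℕ∞) ≤ cat φ := le_iInf₂ fun k hk =>
    Nat.cast_le.2 (le_of_catLE hE hF hψ hψf s π ha hπ hk)
  have h3 := cat_le_TC φ
  exact ⟨le_antisymm (h3.trans h1) h2, le_antisymm h1 (h2.trans h3)⟩

end HomCat

end

theorem mainTheorem6 {n m : ℕ} (f : (Fin n → ℤ) →+ (Fin m → ℤ)) :
    IsGreatest {k : ℕ | HomCat.pullbackBersteinPow (AddMonoidHom.toMultiplicative f) k ≠ 0}
      (Module.finrank ℤ f.range) ∧
    ∀ (X : Type u) (Y : Type v) [TopologicalSpace X] [TopologicalSpace Y]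
      (BG : HomCat.EilenbergMacLane (Multiplicative (Fin n → ℤ)) X)
      (BH : HomCat.EilenbergMacLane (Multiplicative (Fin m → ℤ)) Y)
      (Bf : C(X, Y)), HomCat.Induces BG BH Bf (AddMonoidHom.toMultiplicative f) →
        HomCat.cat Bf = (Module.finrank ℤ f.range : ℕ∞) ∧
        HomCat.TC Bf = (Module.finrank ℤ f.range : ℕ∞) := by
  obtain ⟨r, f', j, s, π, a, hr, hf, ha, hπ⟩ := HomCat.exists_diagonalization f
  rw [← hr]
  exact ⟨HomCat.isGreatest_pullbackBersteinPow_ne_zero mul_comm f'.toMultiplicative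
      j.toMultiplicative hf s.toMultiplicative π.toMultiplicative ha hπ,
    fun X Y _ _ BG BH Bf h => HomCat.cat_TC_eq_of_lattice mul_comm mul_comm (f := f.toMultiplicative)
      f'.toMultiplicative j.toMultiplicative hf s.toMultiplicative π.toMultiplicative ha hπ h⟩
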